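/- Fix $p\in(0,1)$. Consider sandpile configurations $\eta:\mathbb{Z}\to\mathbb{N}=\{0,1,2,\dots\}$, where a vertex $v$ is called unstable if $\eta(v)\ge 2$ and a configuration is stable if it has no unstable vertex. To every vertex $x\in\mathbb{Z}$ attach a stack of instructions $(\xi_{x,i})_{i\in\mathbb{N}}$; all $\xi_{x,i}$ are independent, with $$\mathbb{P}(\xi_{x,i}=\leftarrow)=\mathbb{P}(\xi_{x,i}=\rightarrow)=p(1-p),\qquad \mathbb{P}(\xi_{x,i}=\leftrightarrow)=p^2,\qquad \mathbb{P}(\xi_{x,i}=\varnothing)=(1-p)^2 .$$ The instructions $\leftarrow$, $\rightarrow$, $\leftrightarrow$ move one particle from $x$ to $x-1$, one particle from $x$ to $x+1$, and one particle from $x$ to each of $x-1$ and $x+1$, respectively; $\varnothing$ does nothing. Start with $n\in\mathbb{N}$ particles at the origin and no other particles. As long as the configuration is unstable, apply at each step, at the leftmost unstable vertex, the first instruction of its stack that has not been used yet. For every $n$ this procedure reaches a stable configuration $\eta^{(n)}:\mathbb{Z}\to\{0,1\}$ after finitely many steps, almost surely. Let $$L_n:=\inf\{v\in\mathbb{Z}\mid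 \eta^{(n)}(v)>0\},\qquad R_n:=\sup\{v\in\mathbb{Z}\mid \eta^{(n)}(v)>0\}.$$ Then, as $n\to\infty$, $$\frac{L_n+\frac n2}{\sqrt n}\xrightarrow{\mathcal D}\mathcal N\Big(0,\frac{1-p}{12}\Big)\qquad\text{and}\qquad \frac{R_n-\frac n2}{\sqrt n}\xrightarrow{\mathcal D}\mathcal N\Big(0,\frac{1-p}{12}\Big),$$ where $\xrightarrow{\mathcal D}$ denotes convergence in distribution. -/

import Mathlib

open MeasureTheory ProbabilityTheory Filter Topology

namespace Sandpile

/-- The four toppling instructions: send one particle to the left, send one particle to the right,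
send one particle to each side, or do nothing. -/
inductive Instr : Type
  | left
  | right
  | both
  | none

instance : MeasurableSpace Instr := ⊤

/-- Number of particles that an instruction sends to the left neighbour. -/
def Instr.toLeft : Instr → ℕ
  | .left => 1
  | .right => 0
  | .both => 1
  | .none => 0

/-- Number of particles that an instruction sends to the right neighbour. -/
def Instr.toRight : Instr → ℕ
  | .left => 0
  | .right => 1
  | .both => 1
  | .none => 0

/-- Probability of each instruction in a `p`-toppling. -/
def Instr.prob (p : ℝ) : Instr → ℝ
  | .left => p * (1 - p)
  | .right => p * (1 - p)
  | .both => p ^ 2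
  | .none => (1 - p) ^ 2

/-- `ξ x i` is the `i`-th toppling instruction at the vertex `x`. The instructions are independent
random variables, each distributed as a `p`-toppling. -/
structure IsStack {Ω : Type*} [MeasurableSpace Ω] (p : ℝ) (ξ : ℤ → ℕ → Ω → Instr)
    (μ : Measure Ω) : Prop where
  measurable : ∀ x i, Measurable (ξ x i)
  law : ∀ x i a, μ (ξ x i ⁻¹' {a}) = ENNReal.ofReal (a.prob p)
  indep : iIndepFun (fun q : ℤ × ℕ => ξ q.1 q.2) μ

/-- A configuration is stable if every vertex carries at most one particle. -/
def Stable (η : ℤ → ℕ) : Prop := ∀ v, η v ≤ 1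

/-- Leftmost unstable vertex (of an unstable configuration with finite support). -/
noncomputable def leftmostUnstable (η : ℤ → ℕ) : ℤ := sInf {v | 1 < η v}

/-- Topple the vertex `v` with the instruction `a`. Only vertices with at least two particles are
toppled below, so that the subtraction is never truncated. -/
def topple (η : ℤ → ℕ) (v : ℤ) (a : Instr) : ℤ → ℕ := fun x =>
  η x + (if x = v - 1 then a.toLeft else 0) + (if x = v + 1 then a.toRight else 0)
    - (if x = v then a.toLeft + a.toRight else 0)

/-- A configuration together with the odometer, which counts the topplings at each vertex. -/
structure State where
  config : ℤ → ℕ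
  odometer : ℤ → ℕ

open Classical in
/-- One step of the stabilization with the stacks `s`: topple the leftmost unstable vertex with its
first unused instruction; a stable configuration does not change any more. -/
noncomputable def step (s : ℤ → ℕ → Instr) (σ : State) : State :=
  if Stable σ.config then σ
  else
    let v := leftmostUnstable σ.config
    { config := topple σ.config v (s v (σ.odometer v))
      odometer := σ.odometer + Pi.single v 1 }

/-- The configuration after `k` steps, starting from `n` particles at the origin. -/
noncomputable def config (s : ℤ → ℕ → Instr) (n k : ℕ) : ℤ → ℕ :=
  ((step s)^[k] { config := Pi.single 0 n, odometer := 0 }).config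

/-- The stabilization time of `n` particles at the origin. Its value is meaningful only if the
configuration becomes stable at some time. -/
noncomputable def stabTime (s : ℤ → ℕ → Instr) (n : ℕ) : ℕ := sInf {k | Stable (config s n k)}

/-- The final stable configuration of `n` particles placed at the origin. -/
noncomputable def finalConfig (s : ℤ → ℕ → Instr) (n : ℕ) : ℤ → ℕ := config s n (stabTime s n)

/-- The left boundary vertex of the final stable configuration. -/
noncomputable def leftBdry (s : ℤ → ℕ → Instr) (n : ℕ) : ℤ := sInf {v | 0 < finalConfig s n v}

/-- The right boundary vertex of the final stable configuration. -/
noncomputable def rightBdry (s : ℤ → ℕ → Instr) (n : ℕ) : ℤ := sSup {v | 0 < finalConfig s n v}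

end Sandpile

namespace Sandpile

/-! ### The structure of reachable configurations -/

/-! Two facts combine: a stable reachable configuration is rigid, and its centre of mass is a
martingale.

Rigidity. `HolesSeparated` is preserved by every toppling of an unstable vertex
(`HolesSeparated.topple`). Without an unstable vertex it leaves at most one hole between the
outermost particles, so the final configuration is a block of n or n + 1 consecutive sites with at
most one interior site missing (`Reachable.exists_eq_interval`). Writing M₁ and M₂ for its first and
second moments, both boundaries are M₁/n ∓ n/2 up to O(1), and M₂ is n³/12 up to O(n² + M₁²/n)
(`Reachable.moments_of_stable`).

Martingales. Every toppling reads a fresh instruction, and its place depends only on instructions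
already read; hence the sequence read is i.i.d. (`IsStack.map_word`) and the stacks can be
forgotten. Let T be the number of topplings. Then M₁ is a sum of T centred drifts of variance
2p(1-p), and M₂ - 2pT is a centred sum with L² norm O(n^{5/2}). Comparing with M₂ ≈ n³/12 gives T ≈
t := n³/(24p) with mean error O(n^{5/2}).

Since T is a stopping time, the squared L² distance from M₁ to the sum of the first t drifts is
2p(1-p) E|T - t| = o(n³) (`integral_moment₁_sub_sq_le`). The classical central limit theorem for t
drifts, divided by n√n, has variance 2p(1-p)/(24p) = (1-p)/12. The estimates are carried out at a
deterministic time k, chosen so large that stabilization has occurred by then except with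
probability at most 1/n. -/

/-- Two holes of the configuration that have particles on both outer sides are separated by an
unstable vertex. -/
def HolesSeparated (η : ℤ → ℕ) : Prop :=
  ∀ a b, a < b → η a = 0 → η b = 0 →
    (∀ x ≤ a, η x = 0) ∨ (∀ x, b ≤ x → η x = 0) ∨ ∃ c, a < c ∧ c < b ∧ 2 ≤ η c

lemma holesSeparated_single (n : ℕ) : HolesSeparated (Pi.single 0 n) := by
  intro a b hab _ _
  rcases lt_or_ge a 0 with h | h
  · exact Or.inl fun x hx => Pi.single_eq_of_ne (by omega) _
  · exact Or.inr (Or.inl fun x hx => Pi.single_eq_of_ne (by omega) _)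

/-! ### Effect of one toppling -/

section Topple

variable {η : ℤ → ℕ} {v : ℤ}

lemma topple_self (η : ℤ → ℕ) (v : ℤ) (a : Instr) :
    topple η v a v = η v - (a.toLeft + a.toRight) := by
  have h1 : ¬ v = v - 1 := by omega
  simp [topple, h1]

lemma topple_pred (η : ℤ → ℕ) (v : ℤ) (a : Instr) :
    topple η v a (v - 1) = η (v - 1) + a.toLeft := by
  have h1 : ¬ v - 1 = v + 1 := by omega
  simp [topple, h1]

lemma topple_succ (η : ℤ → ℕ) (v : ℤ) (a : Instr) :
    topple η v a (v + 1) = η (v + 1) + a.toRight := by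
  have h1 : ¬ v + 1 = v - 1 := by omega
  simp [topple, h1]

lemma topple_of_ne (η : ℤ → ℕ) (v : ℤ) (a : Instr) {x : ℤ} (h : x ≠ v) (h1 : x ≠ v - 1)
    (h2 : x ≠ v + 1) : topple η v a x = η x := by
  simp [topple, h, h1, h2]

lemma le_topple (η : ℤ → ℕ) (v : ℤ) (a : Instr) {x : ℤ} (h : x ≠ v) :
    η x ≤ topple η v a x := by
  simp only [topple, if_neg h]; omega

lemma toLeft_le_one (a : Instr) : a.toLeft ≤ 1 := by cases a <;> simp [Instr.toLeft]

lemma toRight_le_one (a : Instr) : a.toRight ≤ 1 := by cases a <;> simp [Instr.toRight]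

/-- Only `v` loses particles, so the property can fail only if `v` becomes a hole or was the
separating unstable vertex. In both cases look at a neighbour that received a particle: either it
was occupied and is now unstable, or it was a hole and the old property applies to it and the hole
beyond. -/
lemma HolesSeparated.topple (h : HolesSeparated η) (hv : 2 ≤ η v) (i : Instr) :
    HolesSeparated (topple η v i) := by
  have hl := toLeft_le_one i
  have hr := toRight_le_one i
  have hs := topple_self η v i
  have hp := topple_pred η v i
  have hq := topple_succ η v i
  set η' := Sandpile.topple η v i with hη'
  have hne : ∀ x, x ≠ v → η x ≤ η' x := fun x hx => le_topple η v i hx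
  have heq : ∀ x, x ≠ v → x ≠ v - 1 → x ≠ v + 1 → η' x = η x :=
    fun x hx hx1 hx2 => topple_of_ne η v i hx hx1 hx2
  intro a b hab ha hb
  -- An empty half-line can only be entered at its end `a`, and `a` is still empty after the
  -- toppling.
  have emptyLeft : (∀ x ≤ a, η x = 0) → ∀ x ≤ a, η' x = 0 := by
    intro hx x hxa
    have h1 : a < v := by
      by_contra hc
      have := hx v (by omega); omega
    by_cases h2 : x = v - 1
    · obtain rfl : a = v - 1 := by omega
      rw [h2]; exact ha
    · rw [heq x (by omega) h2 (by omega)]; exact hx x hxa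
  have emptyRight : (∀ x, b ≤ x → η x = 0) → ∀ x, b ≤ x → η' x = 0 := by
    intro hx x hxa
    have h1 : v < b := by
      by_contra hc
      have := hx v (by omega); omega
    by_cases h2 : x = v + 1
    · obtain rfl : b = v + 1 := by omega
      rw [h2]; exact hb
    · rw [heq x (by omega) (by omega) h2]; exact hx x hxa
  by_cases hav : a = v
  · subst hav
    -- The toppled vertex can be emptied only from height two by `both`.
    have h2 : η a = 2 ∧ i.toLeft = 1 ∧ i.toRight = 1 := by omega
    have hb0 : η b = 0 := by have := hne b (by omega); omega
    have hb1 : b ≠ a + 1 := by rintro rfl; omega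
    by_cases h0 : η (a + 1) = 0
    · rcases h (a + 1) b (by omega) h0 hb0 with h3 | h3 | ⟨c, hc1, hc2, hc3⟩
      · have := h3 a (by omega); omega
      · exact Or.inr (Or.inl (emptyRight h3))
      · exact Or.inr (Or.inr ⟨c, by omega, hc2, hc3.trans (hne c (by omega))⟩)
    · exact Or.inr (Or.inr ⟨a + 1, by omega, by omega, by omega⟩)
  by_cases hbv : b = v
  · subst hbv
    have h2 : η b = 2 ∧ i.toLeft = 1 ∧ i.toRight = 1 := by omega
    have ha0 : η a = 0 := by have := hne a (by omega); omega
    have hb1 : a ≠ b - 1 := by rintro rfl; omega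
    by_cases h0 : η (b - 1) = 0
    · rcases h a (b - 1) (by omega) ha0 h0 with h3 | h3 | ⟨c, hc1, hc2, hc3⟩
      · exact Or.inl (emptyLeft h3)
      · have := h3 b (by omega); omega
      · exact Or.inr (Or.inr ⟨c, by omega, by omega, hc3.trans (hne c (by omega))⟩)
    · exact Or.inr (Or.inr ⟨b - 1, by omega, by omega, by omega⟩)
  have ha0 : η a = 0 := by have := hne a hav; omega
  have hb0 : η b = 0 := by have := hne b hbv; omega
  rcases h a b hab ha0 hb0 with h3 | h3 | ⟨c, hc1, hc2, hc3⟩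
  · exact Or.inl (emptyLeft h3)
  · exact Or.inr (Or.inl (emptyRight h3))
  by_cases hcv : c = v
  · subst hcv
    by_cases h2 : 2 ≤ η' c
    · exact Or.inr (Or.inr ⟨c, hc1, hc2, h2⟩)
    -- The separating vertex lost a particle, so at least one neighbour gained one; argue on that
    -- side.
    by_cases hL : i.toLeft = 1
    · have hac : a ≠ c - 1 := by rintro rfl; omega
      by_cases h0 : η (c - 1) = 0
      · rcases h a (c - 1) (by omega) ha0 h0 with h3 | h3 | ⟨d, hd1, hd2, hd3⟩
        · exact Or.inl (emptyLeft h3)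
        · have := h3 c (by omega); omega
        · exact Or.inr (Or.inr ⟨d, by omega, by omega, hd3.trans (hne d (by omega))⟩)
      · exact Or.inr (Or.inr ⟨c - 1, by omega, by omega, by omega⟩)
    · have hR : i.toRight = 1 := by omega
      have hac : b ≠ c + 1 := by rintro rfl; omega
      by_cases h0 : η (c + 1) = 0
      · rcases h (c + 1) b (by omega) h0 hb0 with h3 | h3 | ⟨d, hd1, hd2, hd3⟩
        · have := h3 c (by omega); omega
        · exact Or.inr (Or.inl (emptyRight h3))
        · exact Or.inr (Or.inr ⟨d, by omega, by omega, hd3.trans (hne d (by omega))⟩)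
      · exact Or.inr (Or.inr ⟨c + 1, by omega, by omega, by omega⟩)
  · exact Or.inr (Or.inr ⟨c, hc1, hc2, hc3.trans (hne c hcv)⟩)

/-- With its mirror image this keeps the origin between the extreme particles, which turns a bound
on the width into a bound on the position. -/
lemma topple_exists_pos_le (hv : 2 ≤ η v) (i : Instr) (h : ∃ x ≤ 0, 0 < η x) :
    ∃ x ≤ 0, 0 < topple η v i x := by
  obtain ⟨x, hx, hx0⟩ := h
  by_cases hxv : x = v
  · subst hxv
    have := topple_self η x i
    have h1 := topple_pred η x i
    have hr := toRight_le_one i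
    by_cases h2 : i.toLeft = 0
    · exact ⟨x, hx, by omega⟩
    · exact ⟨x - 1, by omega, by omega⟩
  · exact ⟨x, hx, hx0.trans_le (le_topple η v i hxv)⟩

lemma topple_exists_pos_ge (hv : 2 ≤ η v) (i : Instr) (h : ∃ x, 0 ≤ x ∧ 0 < η x) :
    ∃ x, 0 ≤ x ∧ 0 < topple η v i x := by
  obtain ⟨x, hx, hx0⟩ := h
  by_cases hxv : x = v
  · subst hxv
    have := topple_self η x i
    have h1 := topple_succ η x i
    have hr := toLeft_le_one i
    by_cases h2 : i.toRight = 0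
    · exact ⟨x, hx, by omega⟩
    · exact ⟨x + 1, by omega, by omega⟩
  · exact ⟨x, hx, hx0.trans_le (le_topple η v i hxv)⟩

lemma topple_cast (hv : 2 ≤ η v) (i : Instr) (x : ℤ) :
    (topple η v i x : ℝ) = η x + (if x = v - 1 then (i.toLeft : ℝ) else 0)
      + (if x = v + 1 then (i.toRight : ℝ) else 0)
      - (if x = v then (i.toLeft : ℝ) + i.toRight else 0) := by
  have hl := toLeft_le_one i
  have hr := toRight_le_one i
  unfold topple
  rw [Nat.cast_sub]
  · push_cast; rfl
  · split_ifs with h1 h2 h3 <;> first | (subst h1; omega) | omega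

/-- Used with `f` equal to 1, x and x², for the conservation of mass and the evolution of the two
moments. -/
lemma sum_mul_topple (B : Finset ℤ) (h0 : v ∈ B) (h1 : v - 1 ∈ B) (h2 : v + 1 ∈ B)
    (hv : 2 ≤ η v) (i : Instr) (f : ℤ → ℝ) :
    ∑ x ∈ B, f x * (topple η v i x : ℝ) = ∑ x ∈ B, f x * (η x : ℝ)
      + (i.toLeft * (f (v - 1) - f v) + i.toRight * (f (v + 1) - f v)) := by
  simp_rw [topple_cast hv, mul_sub, mul_add, Finset.sum_sub_distrib, Finset.sum_add_distrib,
    mul_ite, mul_zero, Finset.sum_ite_eq', if_pos h0, if_pos h1, if_pos h2]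
  ring

end Topple

/-- A box that contains every vertex that `n` particles started at the origin can reach. -/
noncomputable def box (n : ℕ) : Finset ℤ := Finset.Icc (-(2 * n + 1)) (2 * n + 1)

lemma mem_box {n : ℕ} {x : ℤ} : x ∈ box n ↔ -(2 * n + 1) ≤ x ∧ x ≤ 2 * n + 1 := Finset.mem_Icc

/-- The properties of the configurations that can be reached from `n` particles at the origin. -/
structure Reachable (n : ℕ) (η : ℤ → ℕ) : Prop where
  holes : HolesSeparated η
  left : ∃ x ≤ 0, 0 < η x
  right : ∃ x, 0 ≤ x ∧ 0 < η x
  supp : ∀ x, 0 < η x → -(2 * n) ≤ x ∧ x ≤ 2 * n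
  sum : ∑ x ∈ box n, η x = n

/-- Two adjacent holes leave no room for a vertex between them. -/
lemma HolesSeparated.one_le_add {η : ℤ → ℕ} (h : HolesSeparated η) {l r j : ℤ} (hl : 0 < η l)
    (hr : 0 < η r) (hlj : l ≤ j) (hjr : j < r) : 1 ≤ η j + η (j + 1) := by
  by_contra hc
  rcases h j (j + 1) (by omega) (by omega) (by omega) with h1 | h1 | ⟨c, h1, h2, -⟩
  · have := h1 l hlj; omega
  · have := h1 r (by omega); omega
  · omega

/-- Double counting: each adjacent pair in the range contains a particle, and each particle lies in
at most two pairs. -/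
lemma HolesSeparated.sub_le {η : ℤ → ℕ} (h : HolesSeparated η) {n : ℕ} {l r : ℤ} (hl : 0 < η l)
    (hr : 0 < η r) (B : Finset ℤ) (hB : Finset.Icc l r ⊆ B) (hsum : ∑ x ∈ B, η x = n) :
    r - l ≤ 2 * n := by
  rcases lt_or_ge r l with hlr | hlr
  · omega
  have h1 : ∑ j ∈ Finset.Ico l r, 1 ≤ ∑ j ∈ Finset.Ico l r, (η j + η (j + 1)) :=
    Finset.sum_le_sum fun j hj => by
      rw [Finset.mem_Ico] at hj
      exact h.one_le_add hl hr hj.1 hj.2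
  have h2 : ∑ j ∈ Finset.Ico l r, η j ≤ n := hsum ▸
    Finset.sum_le_sum_of_subset (Finset.Ico_subset_Icc_self.trans hB)
  have h3 : ∑ j ∈ Finset.Ico l r, η (j + 1) ≤ n := by
    rw [← hsum, ← Finset.sum_image (f := η) (g := fun j : ℤ => j + 1) (by intro a _ b _; simp)]
    refine Finset.sum_le_sum_of_subset fun x hx => hB ?_
    simp only [Finset.mem_image, Finset.mem_Ico] at hx
    rw [Finset.mem_Icc]; obtain ⟨y, hy, rfl⟩ := hx; omega
  rw [Finset.sum_add_distrib, ← Finset.card_eq_sum_ones, Int.card_Ico] at h1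
  omega

lemma reachable_single {n : ℕ} (hn : 0 < n) : Reachable n (Pi.single 0 n) where
  holes := holesSeparated_single n
  left := ⟨0, le_rfl, by simpa⟩
  right := ⟨0, le_rfl, by simpa⟩
  supp x hx := by
    have : x = 0 := by
      by_contra h
      simp [Pi.single_eq_of_ne h] at hx
    omega
  sum := by
    rw [Finset.sum_pi_single', if_pos (mem_box.2 (by omega))]

/-- The box exceeds the support bound 2n by one, so it contains both neighbours of a toppled vertex.
-/
lemma Reachable.sum_mul_topple {n : ℕ} {η : ℤ → ℕ} (h : Reachable n η) {v : ℤ} (hv : 2 ≤ η v)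
    (i : Instr) (f : ℤ → ℝ) :
    ∑ x ∈ box n, f x * (topple η v i x : ℝ) = ∑ x ∈ box n, f x * (η x : ℝ)
      + (i.toLeft * (f (v - 1) - f v) + i.toRight * (f (v + 1) - f v)) := by
  have := h.supp v (by omega)
  exact Sandpile.sum_mul_topple _ (mem_box.2 (by omega)) (mem_box.2 (by omega))
    (mem_box.2 (by omega)) hv i f

lemma Reachable.topple {n : ℕ} {η : ℤ → ℕ} (h : Reachable n η) {v : ℤ} (hv : 2 ≤ η v)
    (i : Instr) : Reachable n (topple η v i) := by
  have hsum : ∑ x ∈ box n, Sandpile.topple η v i x = n := by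
    have h1 := h.sum_mul_topple hv i (fun _ => 1)
    simp only [one_mul, sub_self, mul_zero, add_zero] at h1
    refine Eq.trans ?_ h.sum
    exact_mod_cast h1
  have hh := h.holes.topple hv i
  have hl := topple_exists_pos_le hv i h.left
  have hr := topple_exists_pos_ge hv i h.right
  -- The crude support bound grows by one; the width bound, applied with occupied vertices on both
  -- sides of the origin, then restores 2n.
  have hbox : ∀ x, 0 < Sandpile.topple η v i x → -(2 * n + 1) ≤ x ∧ x ≤ 2 * n + 1 := by
    intro x hx
    have hvs := h.supp v (by omega)
    by_cases h1 : x = v - 1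
    · omega
    by_cases h2 : x = v + 1
    · omega
    by_cases h3 : x = v
    · omega
    rw [topple_of_ne η v i h3 h1 h2] at hx
    have := h.supp x hx
    omega
  refine ⟨hh, hl, hr, fun x hx => ?_, hsum⟩
  obtain ⟨l, hl0, hl⟩ := hl
  obtain ⟨r, hr0, hr⟩ := hr
  have hlb := hbox l hl
  have hrb := hbox r hr
  have hxb := hbox x hx
  have key := fun (y z : ℤ) (hy : 0 < Sandpile.topple η v i y) (hz : 0 < Sandpile.topple η v i z) =>
    hh.sub_le hy hz (box n) (fun w hw => by
      rw [Finset.mem_Icc] at hw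
      have := hbox y hy
      have := hbox z hz
      exact mem_box.2 (by omega)) hsum
  have := key l x hl hx
  have := key x r hx hr
  omega

lemma Reachable.one_lt_leftmostUnstable {n : ℕ} {η : ℤ → ℕ} (h : Reachable n η)
    (hs : ¬ Stable η) : 1 < η (leftmostUnstable η) := by
  have hne : {v | 1 < η v}.Nonempty := by
    simp only [Stable, not_forall, not_le] at hs
    exact hs
  refine Int.csInf_mem hne ⟨-(2 * n), fun x hx => ?_⟩
  simp only [Set.mem_ofPred_eq] at hx
  exact (h.supp x (by omega)).1

/-! ### Stable reachable configurations -/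

/-- A stable reachable configuration is an interval with at most one hole; if there is no hole, then
the vertex to the right of the interval is chosen as `h`. -/
lemma Reachable.exists_eq_interval {n : ℕ} {η : ℤ → ℕ} (hr : Reachable n η)
    (hs : Stable η) : ∃ L h : ℤ, L < h ∧ h ≤ L + n ∧
      ∀ x, η x = if x ∈ (Finset.Icc L (L + n)).erase h then 1 else 0 := by
  set S := (box n).filter (fun x => 0 < η x) with hS
  have memS : ∀ x, x ∈ S ↔ 0 < η x := fun x => by
    simp only [hS, Finset.mem_filter, and_iff_right_iff_imp]
    intro hx
    have := hr.supp x hx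
    exact mem_box.2 (by omega)
  have hval : ∀ x, η x = if x ∈ S then 1 else 0 := fun x => by
    have := hs x
    split_ifs with h <;> rw [memS] at h <;> omega
  have hcard : S.card = n := by
    rw [← hr.sum, Finset.card_eq_sum_ones, hS, Finset.sum_filter]
    refine Finset.sum_congr rfl fun x _ => ?_
    have := hs x
    split_ifs <;> omega
  have hne : S.Nonempty := by
    obtain ⟨x, -, hx⟩ := hr.left
    exact ⟨x, (memS x).2 hx⟩
  set L := S.min' hne
  set R := S.max' hne
  have hLS : L ∈ S := S.min'_mem hne
  have hRS : R ∈ S := S.max'_mem hne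
  have hLR : L ≤ R := S.min'_le _ hRS
  have hsub : S ⊆ Finset.Icc L R := fun x hx => Finset.mem_Icc.2 ⟨S.min'_le _ hx, S.le_max' _ hx⟩
  -- Two missing sites between the extreme particles would require an unstable vertex.
  have hdiff : (Finset.Icc L R \ S).card ≤ 1 := by
    rw [Finset.card_le_one]
    have key : ∀ a ∈ Finset.Icc L R \ S, ∀ b ∈ Finset.Icc L R \ S, ¬ a < b := by
      intro a ha b hb hab
      simp only [Finset.mem_sdiff, Finset.mem_Icc, memS] at ha hb
      rw [memS] at hLS hRS
      rcases hr.holes a b hab (by omega) (by omega) with h | h | ⟨c, -, -, h⟩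
      · have := h L (by omega); omega
      · have := h R (by omega); omega
      · have := hs c; omega
    intro a ha b hb
    have := key a ha b hb
    have := key b hb a ha
    omega
  have hc := Finset.card_sdiff_add_card_eq_card hsub
  rw [hcard, Int.card_Icc] at hc
  rcases Nat.lt_or_ge (Finset.Icc L R \ S).card 1 with h0 | h1
  · have hSeq : S = Finset.Icc L R := by
      refine hsub.antisymm ?_
      rw [← Finset.sdiff_eq_empty_iff_subset, ← Finset.card_eq_zero]; omega
    refine ⟨L, L + n, by omega, le_rfl, fun x => ?_⟩
    rw [hval, hSeq]
    congr 1
    simp only [Finset.mem_Icc, Finset.mem_erase, eq_iff_iff]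
    omega
  · obtain ⟨h, hh⟩ := Finset.card_eq_one.1 (le_antisymm hdiff h1)
    have hhm : h ∈ Finset.Icc L R \ S := by rw [hh]; simp
    rw [Finset.mem_sdiff, Finset.mem_Icc] at hhm
    have hhL : h ≠ L := by rintro rfl; exact hhm.2 hLS
    refine ⟨L, h, by omega, by omega, fun x => ?_⟩
    rw [hval]
    congr 1
    have hx : x ∈ Finset.Icc L R \ S ↔ x = h := by rw [hh]; simp
    have hx' := @hsub x
    rw [Finset.mem_sdiff] at hx
    have hR : R = L + n := by omega
    rw [← hR, Finset.mem_erase, eq_iff_iff]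
    tauto

lemma sum_Icc_add_natCast (L : ℤ) (n : ℕ) (f : ℤ → ℝ) :
    ∑ x ∈ Finset.Icc L (L + n), f x = ∑ i ∈ Finset.range (n + 1), f (L + i) := by
  symm
  refine Finset.sum_bij (fun i _ => L + i) (fun i hi => ?_) (fun i _ j _ h => by simpa using h)
    (fun x hx => ?_) (fun _ _ => rfl)
  · rw [Finset.mem_range] at hi; rw [Finset.mem_Icc]; omega
  · rw [Finset.mem_Icc] at hx
    exact ⟨(x - L).toNat, by rw [Finset.mem_range]; omega, by omega⟩

lemma sum_range_add (L : ℝ) (n : ℕ) :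
    ∑ i ∈ Finset.range (n + 1), (L + i) = (n + 1) * (L + n / 2) := by
  induction n with
  | zero => simp
  | succ n ih => rw [Finset.sum_range_succ, ih]; push_cast; ring

lemma sum_range_add_sq (L : ℝ) (n : ℕ) :
    ∑ i ∈ Finset.range (n + 1), (L + i) ^ 2
      = (n + 1) * (L + n / 2) ^ 2 + n * (n + 1) * (n + 2) / 12 := by
  induction n with
  | zero => simp
  | succ n ih => rw [Finset.sum_range_succ, ih]; push_cast; ring

/-- The first moment of a configuration. -/
noncomputable def moment₁ (n : ℕ) (η : ℤ → ℕ) : ℝ := ∑ x ∈ box n, (x : ℝ) * η x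

/-- The second moment of a configuration. -/
noncomputable def moment₂ (n : ℕ) (η : ℤ → ℕ) : ℝ := ∑ x ∈ box n, (x : ℝ) ^ 2 * η x

/-- The boundaries and the moments of a stable reachable configuration. -/
lemma Reachable.moments_of_stable {n : ℕ} (hn : 0 < n) {η : ℤ → ℕ} (hr : Reachable n η)
    (hs : Stable η) :
    |((sInf {v | 0 < η v} : ℤ) : ℝ) + n / 2 - moment₁ n η / n| ≤ 1 / 2 ∧
    |((sSup {v | 0 < η v} : ℤ) : ℝ) - n / 2 - moment₁ n η / n| ≤ 3 / 2 ∧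
    |moment₂ n η - (n : ℝ) ^ 3 / 12| ≤ 2 * n * (|moment₁ n η| / n + 1 / 2) ^ 2 + 5 * n ^ 2 := by
  obtain ⟨L, h, hLh, hhL, hη⟩ := hr.exists_eq_interval hs
  have hn' : (0 : ℝ) < n := by exact_mod_cast hn
  have hn1 : (1 : ℝ) ≤ n := by exact_mod_cast hn
  have hLh' : (L : ℝ) + 1 ≤ h := by exact_mod_cast hLh
  have hhL' : (h : ℝ) ≤ L + n := by exact_mod_cast hhL
  have hmem : h ∈ Finset.Icc L (L + n) := Finset.mem_Icc.2 (by omega)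
  have hsub : (Finset.Icc L (L + n)).erase h ⊆ box n := fun x hx => by
    have h1 := hη x
    rw [if_pos hx] at h1
    have := hr.supp x (by omega)
    exact mem_box.2 (by omega)
  have hsum : ∀ f : ℤ → ℝ, ∑ x ∈ box n, f x * η x
      = ∑ i ∈ Finset.range (n + 1), f (L + i) - f h := by
    intro f
    rw [← sum_Icc_add_natCast, ← Finset.add_sum_erase _ _ hmem, add_sub_cancel_left,
      ← Finset.inter_eq_right.2 hsub, ← Finset.sum_ite_mem]
    refine Finset.sum_congr rfl fun x _ => ?_
    rw [hη x]; split_ifs <;> simp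
  have hM : moment₁ n η = (n + 1) * (L + n / 2) - h := by
    have := hsum (fun x => (x : ℝ))
    push_cast at this
    rw [sum_range_add] at this
    exact this
  have hQ : moment₂ n η = (n + 1) * (L + n / 2) ^ 2 + n * (n + 1) * (n + 2) / 12 - (h : ℝ) ^ 2 := by
    have := hsum (fun x => (x : ℝ) ^ 2)
    push_cast at this
    rw [sum_range_add_sq] at this
    exact this
  have hset : {v | 0 < η v} = {v | v ∈ (Finset.Icc L (L + n)).erase h} := by
    ext x
    simp only [Set.mem_ofPred_eq, hη x]
    split_ifs with hx <;> simp [hx]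
  have hInf : sInf {v | 0 < η v} = L := by
    rw [hset]
    refine IsLeast.csInf_eq ⟨?_, fun x hx => ?_⟩
    · simp; omega
    · simp at hx; omega
  -- The maximum drops to L + n - 1 exactly when the omitted site is the right end; this raises the
  -- error from 1/2 to 3/2.
  have hSup : L + n - 1 ≤ sSup {v | 0 < η v} ∧ sSup {v | 0 < η v} ≤ L + n := by
    rw [hset]
    by_cases hh : h = L + n
    · have : IsGreatest {v | v ∈ (Finset.Icc L (L + n)).erase h} (L + n - 1) := by
        refine ⟨?_, fun x hx => ?_⟩
        · simp; omega
        · simp at hx; omega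
      rw [this.csSup_eq]; omega
    · have : IsGreatest {v | v ∈ (Finset.Icc L (L + n)).erase h} (L + n) := by
        refine ⟨?_, fun x hx => ?_⟩
        · simp; omega
        · simp at hx; omega
      rw [this.csSup_eq]; omega
  have hSup' : (L : ℝ) + n - 1 ≤ ((sSup {v | 0 < η v} : ℤ) : ℝ) ∧
      ((sSup {v | 0 < η v} : ℤ) : ℝ) ≤ L + n := by exact_mod_cast hSup
  set δ : ℝ := (L : ℝ) + n / 2 with hδ
  set m : ℝ := moment₁ n η / n with hm
  have hMn : moment₁ n η = n * m := by rw [hm]; field_simp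
  -- M₁ = nδ - (h - δ), and h - δ lies between 1 - n/2 and n/2.
  have hm1 : δ - 1 / 2 ≤ m ∧ m ≤ δ + 1 / 2 := by
    constructor
    · rw [hm, le_div_iff₀ hn', hM]; nlinarith
    · rw [hm, div_le_iff₀ hn', hM]; nlinarith
  have hδm : |δ - m| ≤ 1 / 2 := abs_le.2 ⟨by linarith, by linarith⟩
  have hδa : |δ| ≤ |moment₁ n η| / n + 1 / 2 := by
    have h1 : |m| = |moment₁ n η| / n := by rw [hm, abs_div, abs_of_pos hn']
    rw [← h1]
    have := abs_sub_abs_le_abs_sub δ m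
    linarith
  refine ⟨by rw [hInf]; exact hδm, ?_, ?_⟩
  · rw [abs_le]; constructor <;> linarith [hSup'.1, hSup'.2, hm1.1, hm1.2]
  · have hh2 : (h : ℝ) ^ 2 ≤ 4 * n ^ 2 := by
      have hLs : -(2 * n : ℝ) ≤ L := by
        have h1 := hη L
        rw [if_pos (by simp; omega)] at h1
        exact_mod_cast (hr.supp L (by omega)).1
      have hRs : (h : ℝ) ≤ 2 * n := by
        by_cases hh : h = L + n
        · have h1 := hη (L + n - 1)
          rw [if_pos (by simp; omega)] at h1
          have h2 := (hr.supp _ (by rw [h1]; exact one_pos)).2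
          -- The support bound alone gives only h ≤ 2n + 1; an occupied vertex at or left of 0
          -- forces L ≤ 0, hence h ≤ n.
          have h3 := hr.left
          obtain ⟨x, hx0, hx⟩ := h3
          have h4 : x ∈ (Finset.Icc L (L + n)).erase h := by
            by_contra hc
            have := hη x; rw [if_neg hc] at this; omega
          simp at h4
          have : h ≤ 2 * n := by omega
          exact_mod_cast this
        · have h1 := hη (L + n)
          rw [if_pos (by simp; omega)] at h1
          have h2 := (hr.supp _ (by rw [h1]; exact one_pos)).2
          have : h ≤ 2 * n := by omega
          exact_mod_cast this
      nlinarith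
    have hδ2 : δ ^ 2 ≤ (|moment₁ n η| / n + 1 / 2) ^ 2 := by
      rw [← sq_abs]; exact pow_le_pow_left₀ (abs_nonneg _) hδa 2
    -- The errors are (n+1)δ² ≤ 2nδ², h² ≤ 4n² and (3n² + 2n)/12 ≤ n².
    rw [hQ, abs_le]
    constructor <;> nlinarith [sq_nonneg δ, sq_nonneg (h : ℝ)]

/-! ### The trajectory driven by a single sequence of instructions -/

/-- The configuration is toppled at its leftmost unstable vertex, if there is one. -/
noncomputable def toppleLeftmost (η : ℤ → ℕ) (a : Instr) : ℤ → ℕ :=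
  open Classical in if Stable η then η else topple η (leftmostUnstable η) a

/-- The configuration after `k` steps, if the instruction that is used in step `i` is `w i`. -/
noncomputable def traj (n : ℕ) (w : ℕ → Instr) : ℕ → ℤ → ℕ
  | 0 => Pi.single 0 n
  | k + 1 => toppleLeftmost (traj n w k) (w k)

lemma toppleLeftmost_of_stable {η : ℤ → ℕ} (h : Stable η) (a : Instr) :
    toppleLeftmost η a = η := if_pos h

lemma toppleLeftmost_of_not_stable {η : ℤ → ℕ} (h : ¬ Stable η) (a : Instr) :
    toppleLeftmost η a = topple η (leftmostUnstable η) a := if_neg h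

lemma reachable_traj {n : ℕ} (hn : 0 < n) (w : ℕ → Instr) (k : ℕ) : Reachable n (traj n w k) := by
  induction k with
  | zero => exact reachable_single hn
  | succ k ih =>
    by_cases h : Stable (traj n w k)
    · rw [traj, toppleLeftmost_of_stable h]; exact ih
    · rw [traj, toppleLeftmost_of_not_stable h]
      exact ih.topple (ih.one_lt_leftmostUnstable h) _

lemma traj_eq_of_stable {n : ℕ} {w : ℕ → Instr} {k l : ℕ} (h : Stable (traj n w k)) (hkl : k ≤ l) :
    traj n w l = traj n w k := by
  induction l, hkl using Nat.le_induction with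
  | base => rfl
  | succ l _ ih => rw [traj, toppleLeftmost_of_stable (ih ▸ h), ih]

lemma traj_congr {n : ℕ} {w w' : ℕ → Instr} {k : ℕ} (h : ∀ i < k, w i = w' i) :
    traj n w k = traj n w' k := by
  induction k with
  | zero => rfl
  | succ k ih => rw [traj, traj, ih fun i hi => h i (by omega), h k (by omega)]

/-! ### From stacks of instructions to a single sequence of instructions -/

/-- The leftmost unstable vertex, or the origin if the configuration is stable. -/
noncomputable def activeVertex (η : ℤ → ℕ) : ℤ :=
  open Classical in if Stable η then 0 else leftmostUnstable η

/-- The number of steps before step `k` in which a given vertex was active. -/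
noncomputable def visits (n : ℕ) (w : ℕ → Instr) : ℕ → ℤ → ℕ
  | 0 => 0
  | k + 1 => visits n w k + Pi.single (activeVertex (traj n w k)) 1

/-- The active vertex in step `k` and the number of its previous visits. -/
noncomputable def address (n : ℕ) (w : ℕ → Instr) (k : ℕ) : ℤ × ℕ :=
  (activeVertex (traj n w k), visits n w k (activeVertex (traj n w k)))

/-- A step of the stabilization that goes on reading instructions at the origin when the
configuration is stable. -/
noncomputable def readStep (s : ℤ → ℕ → Instr) (σ : State) : State where
  config := toppleLeftmost σ.config
    (s (activeVertex σ.config) (σ.odometer (activeVertex σ.config)))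
  odometer := σ.odometer + Pi.single (activeVertex σ.config) 1

/-- The state after `k` steps of `readStep`. -/
noncomputable def readState (s : ℤ → ℕ → Instr) (n k : ℕ) : State :=
  (readStep s)^[k] { config := Pi.single 0 n, odometer := 0 }

/-- The sequence of the instructions that `readStep` reads. -/
noncomputable def word (s : ℤ → ℕ → Instr) (n k : ℕ) : Instr :=
  s (activeVertex (readState s n k).config)
    ((readState s n k).odometer (activeVertex (readState s n k).config))

lemma readState_succ (s : ℤ → ℕ → Instr) (n k : ℕ) :
    readState s n (k + 1) = readStep s (readState s n k) := Function.iterate_succ_apply' _ _ _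

lemma readState_eq (s : ℤ → ℕ → Instr) (n k : ℕ) :
    readState s n k = ⟨traj n (word s n) k, visits n (word s n) k⟩ := by
  induction k with
  | zero => rfl
  | succ k ih =>
    rw [readState_succ, readStep, traj, visits, word, ih]

lemma word_eq (s : ℤ → ℕ → Instr) (n k : ℕ) :
    word s n k = s (address n (word s n) k).1 (address n (word s n) k).2 := by
  conv_lhs => rw [word, readState_eq]
  rfl

/-- `step` freezes the odometer at stability while `readStep` goes on counting at the origin. So the
states agree up to stabilization, and afterwards only the configurations do. -/
lemma config_eq_traj (s : ℤ → ℕ → Instr) (n k : ℕ) : config s n k = traj n (word s n) k := by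
  suffices h : (step s)^[k] { config := Pi.single 0 n, odometer := 0 } = readState s n k ∨
      (Stable (traj n (word s n) k) ∧ config s n k = traj n (word s n) k) by
    rcases h with h | h
    · rw [config, h, readState_eq]
    · exact h.2
  induction k with
  | zero => exact Or.inl rfl
  | succ k ih =>
    have hsucc : config s n (k + 1)
        = (step s ((step s)^[k] { config := Pi.single 0 n, odometer := 0 })).config := by
      rw [config, Function.iterate_succ_apply']
    by_cases hst : Stable (traj n (word s n) k)
    · have hk : config s n k = traj n (word s n) k := by
        rcases ih with ih | ih
        · rw [config, ih, readState_eq]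
        · exact ih.2
      right
      rw [traj, toppleLeftmost_of_stable hst, hsucc, step, if_pos (by rw [← config, hk]; exact hst)]
      exact ⟨hst, hk⟩
    · left
      rcases ih with ih | ih
      · rw [Function.iterate_succ_apply', ih, readState_succ, step, readStep]
        have hc : (readState s n k).config = traj n (word s n) k := by rw [readState_eq]
        rw [if_neg (by rw [hc]; exact hst)]
        have ha : activeVertex (readState s n k).config
            = leftmostUnstable (readState s n k).config := by
          rw [activeVertex, if_neg (by rw [hc]; exact hst)]
        simp only [ha, toppleLeftmost_of_not_stable (hc ▸ hst)]
      · exact absurd ih.1 hst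

lemma visits_congr {n : ℕ} {w w' : ℕ → Instr} {k : ℕ} (h : ∀ i < k, w i = w' i) :
    visits n w k = visits n w' k := by
  induction k with
  | zero => rfl
  | succ k ih =>
    rw [visits, visits, ih fun i hi => h i (by omega),
      traj_congr (n := n) (k := k) fun i hi => h i (by omega)]

/-- Predictability: where instruction `k` is read depends only on earlier instructions. -/
lemma address_congr {n : ℕ} {w w' : ℕ → Instr} {k : ℕ} (h : ∀ i < k, w i = w' i) :
    address n w k = address n w' k := by
  rw [address, address, visits_congr h, traj_congr h]

lemma visits_mono (n : ℕ) (w : ℕ → Instr) (x : ℤ) : Monotone fun k => visits n w k x :=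
  monotone_nat_of_le_succ fun k => by simp [visits]

/-- Each reading raises the visit count of its vertex, so no instruction is read twice. -/
lemma address_injective (n : ℕ) (w : ℕ → Instr) : Function.Injective (address n w) := by
  have key : ∀ i j, i < j → address n w i ≠ address n w j := by
    intro i j hij h
    simp only [address, Prod.mk.injEq] at h
    obtain ⟨h1, h2⟩ := h
    rw [← h1] at h2
    have h3 := visits_mono n w (activeVertex (traj n w i)) (Nat.succ_le_of_lt hij)
    simp [visits] at h3
    omega
  intro i j h
  rcases lt_trichotomy i j with hij | hij | hij
  · exact absurd h (key i j hij)
  · exact hij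
  · exact absurd h.symm (key j i hij)

/-- The sequence of instructions starts with `w` if and only if these instructions are found at the
addresses that `w` leads to. -/
lemma word_eq_iff (s : ℤ → ℕ → Instr) (n : ℕ) (w : ℕ → Instr) (m : ℕ) :
    (∀ i < m, word s n i = w i) ↔ ∀ i < m, s (address n w i).1 (address n w i).2 = w i := by
  induction m with
  | zero => simp
  | succ m ih =>
    rw [Nat.forall_lt_succ_right, Nat.forall_lt_succ_right, ← ih]
    refine and_congr_right fun h => ?_
    rw [word_eq, address_congr h]

instance : Finite Instr :=
  -- The code is the pair of truth values "sends left" and "sends right"; the third entry of the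
  -- triple is discarded.
  Finite.of_injective (fun a : Instr => (a.toLeft, a.toRight, a.toLeft) |>.map
    (fun i => decide (i = 1)) (fun j => decide (j.1 = 1))) (by
      intro a b; cases a <;> cases b <;> simp [Instr.toLeft, Instr.toRight])

instance : MeasurableSingletonClass Instr := ⟨fun _ => trivial⟩

instance : DiscreteMeasurableSpace Instr := ⟨fun _ => trivial⟩

/-- A measure on sequences is a product measure if its values on cylinders are the products. -/
lemma eq_infinitePi_of_cylinder {ν : Measure Instr} [IsProbabilityMeasure ν]
    {Q : Measure (ℕ → Instr)}
    (h : ∀ (m : ℕ) (w : ℕ → Instr), Q {x | ∀ i < m, x i = w i} = ∏ i ∈ Finset.range m, ν {w i}) :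
    Q = Measure.infinitePi fun _ : ℕ => ν := by
  refine Measure.eq_infinitePi _ fun s t ht => ?_
  rw [← Measure.infinitePi_pi (fun _ : ℕ => ν) fun i _ => ht i]
  obtain ⟨m, hm⟩ := s.exists_nat_subset_range
  set r : (ℕ → Instr) → (Fin m → Instr) := fun x i => x i with hr
  have hrm : Measurable r := by fun_prop
  have hpre : (s : Set ℕ).pi t = r ⁻¹' {f | ∀ i : Fin m, (i : ℕ) ∈ s → f i ∈ t i} := by
    ext x
    simp only [Set.mem_pi, Finset.mem_coe, Set.mem_preimage, Set.mem_ofPred_eq, hr]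
    exact ⟨fun hx i hi => hx i hi, fun hx i hi => hx ⟨i, Finset.mem_range.1 (hm hi)⟩ hi⟩
  -- Only `m` coordinates matter, and on the finite space of words of length `m` measures are
  -- compared on points, that is, on cylinders.
  have hmap : Q.map r = (Measure.infinitePi fun _ : ℕ => ν).map r := by
    refine Measure.ext_of_singleton fun f => ?_
    rw [Measure.map_apply hrm (measurableSet_singleton f),
      Measure.map_apply hrm (measurableSet_singleton f)]
    obtain ⟨w, hw⟩ : ∃ w : ℕ → Instr, ∀ i : Fin m, w i = f i :=
      ⟨fun i => if hi : i < m then f ⟨i, hi⟩ else .none, fun i => by simp⟩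
    have h1 : r ⁻¹' {f} = {x | ∀ i < m, x i = w i} := by
      ext x
      simp only [hr, Set.mem_preimage, Set.mem_singleton_iff, funext_iff, Set.mem_ofPred_eq]
      exact ⟨fun hx i hi => by rw [hw ⟨i, hi⟩]; exact hx ⟨i, hi⟩,
        fun hx i => by rw [← hw i]; exact hx i i.2⟩
    have h2 : {x : ℕ → Instr | ∀ i < m, x i = w i}
        = (Finset.range m : Set ℕ).pi fun i => {w i} := by
      ext x; simp
    rw [h1, h]
    rw [h2, Measure.infinitePi_pi _ fun i _ => measurableSet_singleton _]
  rw [hpre, ← Measure.map_apply hrm (Set.toFinite _).measurableSet, hmap,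
    Measure.map_apply hrm (Set.toFinite _).measurableSet]

/-- Once the word `w` is prescribed, the random addresses become the deterministic `address n w i`.
-/
lemma setOf_word_eq {Ω : Type*} (ξ : ℤ → ℕ → Ω → Instr) (n m : ℕ) (w : ℕ → Instr) :
    {ω | ∀ i < m, word (fun x j => ξ x j ω) n i = w i}
      = ⋂ i ∈ Finset.range m, ξ (address n w i).1 (address n w i).2 ⁻¹' {w i} := by
  ext ω
  simp [word_eq_iff]

/-! ### The law of the instructions read -/

section Law

variable {Ω : Type*} [MeasurableSpace Ω] {μ : Measure Ω} {p : ℝ} {ξ : ℤ → ℕ → Ω → Instr}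

lemma IsStack.measurable_word (hξ : IsStack p ξ μ) (n : ℕ) :
    Measurable fun ω => word (fun x j => ξ x j ω) n := by
  rw [measurable_pi_iff]
  intro k
  have h : Measurable fun ω (i : Fin (k + 1)) => word (fun x j => ξ x j ω) n i := by
    refine measurable_to_countable' fun f => ?_
    obtain ⟨w, hw⟩ : ∃ w : ℕ → Instr, ∀ i : Fin (k + 1), w i = f i :=
      ⟨fun i => if hi : i < k + 1 then f ⟨i, hi⟩ else .none, fun i => dif_pos i.2⟩
    have h1 : (fun ω (i : Fin (k + 1)) => word (fun x j => ξ x j ω) n i) ⁻¹' {f}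
        = {ω | ∀ i < k + 1, word (fun x j => ξ x j ω) n i = w i} := by
      ext ω
      simp only [Set.mem_preimage, Set.mem_singleton_iff, funext_iff, Set.mem_ofPred_eq]
      exact ⟨fun hx i hi => by rw [hw ⟨i, hi⟩]; exact hx ⟨i, hi⟩,
        fun hx i => by rw [← hw i]; exact hx i i.2⟩
    rw [h1, setOf_word_eq]
    exact Finset.measurableSet_biInter _ fun i _ =>
      hξ.measurable _ _ (measurableSet_singleton _)
  exact (measurable_pi_apply (⟨k, by omega⟩ : Fin (k + 1))).comp h

/-- The sequence of the instructions that are read is independent and identically distributed. -/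
lemma IsStack.map_word (hξ : IsStack p ξ μ) {ν : Measure Instr}
    [IsProbabilityMeasure ν] (hν : ∀ a, ν {a} = ENNReal.ofReal (a.prob p)) (n : ℕ) :
    μ.map (fun ω => word (fun x j => ξ x j ω) n) = Measure.infinitePi fun _ : ℕ => ν := by
  refine eq_infinitePi_of_cylinder fun m w => ?_
  rw [Measure.map_apply (hξ.measurable_word n)]
  · have h1 := setOf_word_eq ξ n m w
    rw [Set.preimage_ofPred_eq, h1]
    -- For fixed `w` the addresses are fixed and distinct, so the independence of the stacks applies
    -- directly.
    have h2 := hξ.indep.precomp (address_injective n w)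
    rw [iIndepFun.measure_inter_preimage_eq_mul h2 (Finset.range m) (sets := fun i => {w i})
      fun i _ => measurableSet_singleton _]
    exact Finset.prod_congr rfl fun i _ => by rw [hν]; exact hξ.law _ _ _
  · have h2 : {x : ℕ → Instr | ∀ i < m, x i = w i}
        = (Finset.range m : Set ℕ).pi fun i => {w i} := by
      ext x; simp
    rw [h2]
    exact MeasurableSet.pi (Finset.countable_toSet _) fun i _ => measurableSet_singleton _

end Law

/-! ### Functions of finitely many instructions -/

/-- The law of a sequence of independent instructions with law `ν`. -/
noncomputable abbrev wordMeasure (ν : Measure Instr) : Measure (ℕ → Instr) :=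
  Measure.infinitePi fun _ : ℕ => ν

lemma integral_add_three {Ω : Type*} [MeasurableSpace Ω] {μ : Measure Ω} {f g h : Ω → ℝ}
    (hf : Integrable f μ) (hg : Integrable g μ) (hh : Integrable h μ) :
    ∫ w, (f w + g w + h w) ∂μ = ∫ w, f w ∂μ + ∫ w, g w ∂μ + ∫ w, h w ∂μ := by
  rw [← integral_add hf hg]
  exact integral_add (hf.add hg) hh

section DependsOnFirst

/-- The function `f` depends only on the first `k` instructions. -/
def DependsOnFirst (k : ℕ) (f : (ℕ → Instr) → ℝ) : Prop :=
  ∀ ⦃x y : ℕ → Instr⦄, (∀ i < k, x i = y i) → f x = f y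

lemma DependsOnFirst.exists_eq_comp {f : (ℕ → Instr) → ℝ} {k : ℕ} (hf : DependsOnFirst k f) :
    ∃ g : (Finset.range k → Instr) → ℝ, f = fun w => g fun i => w i := by
  refine ⟨fun y => f fun i => if hi : i ∈ Finset.range k then y ⟨i, hi⟩ else .none, ?_⟩
  funext w
  refine hf fun i hi => ?_
  rw [dif_pos (Finset.mem_range.2 hi)]

lemma DependsOnFirst.measurable {f : (ℕ → Instr) → ℝ} {k : ℕ} (hf : DependsOnFirst k f) :
    Measurable f := by
  obtain ⟨g, rfl⟩ := hf.exists_eq_comp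
  exact (measurable_of_finite g).comp (by fun_prop)

variable {ν : Measure Instr} [IsProbabilityMeasure ν]

/-- Such a function takes finitely many values, so integrability never requires a bound. -/
lemma DependsOnFirst.integrable {f : (ℕ → Instr) → ℝ} {k : ℕ} (hf : DependsOnFirst k f) :
    Integrable f (wordMeasure ν) := by
  obtain ⟨g, rfl⟩ := hf.exists_eq_comp
  have hm : Measurable fun (w : ℕ → Instr) (i : Finset.range k) => w i := by fun_prop
  have := Measure.isProbabilityMeasure_map (μ := wordMeasure ν) hm.aemeasurable
  exact (Integrable.of_finite (f := g)).comp_measurable hm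

lemma dependsOn_comp_eval (z : Instr → ℝ) {i k : ℕ} (hik : i < k) :
    DependsOnFirst k (fun w : ℕ → Instr => z (w i)) := fun x y h => by
  simp only [h i hik]

lemma DependsOnFirst.mono {f : (ℕ → Instr) → ℝ} {i k : ℕ} (hf : DependsOnFirst i f)
    (hik : i ≤ k) : DependsOnFirst k f :=
  fun _ _ h => hf fun j hj => h j (lt_of_lt_of_le hj hik)

lemma dependsOn_sum {A : ℕ → (ℕ → Instr) → ℝ} {k l : ℕ}
    (hA : ∀ i < l, DependsOnFirst k (A i)) :
    DependsOnFirst k (fun w => ∑ i ∈ Finset.range l, A i w) := fun _ _ h =>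
  Finset.sum_congr rfl fun i hi => hA i (Finset.mem_range.1 hi) h

lemma dependsOn_sum_mul_eval {A : ℕ → (ℕ → Instr) → ℝ}
    (hA : ∀ i, DependsOnFirst i (A i)) (z : Instr → ℝ) (k : ℕ) :
    DependsOnFirst k (fun w => ∑ i ∈ Finset.range k, A i w * z (w i)) :=
  dependsOn_sum fun i hi x y h => by
    rw [((hA i).mono hi.le) h, h i hi]

/-- Instruction `k` is independent of the first `k` ones, numbered from 0; this is the martingale
property in the form used below. -/
lemma integral_mul_eval {f : (ℕ → Instr) → ℝ} {k : ℕ} (hf : DependsOnFirst k f)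
    (z : Instr → ℝ) :
    ∫ w, f w * z (w k) ∂wordMeasure ν = (∫ w, f w ∂wordMeasure ν) * ∫ a, z a ∂ν := by
  have hz : ∫ w, z (w k) ∂wordMeasure ν = ∫ a, z a ∂ν := by
    have := integral_map (μ := wordMeasure ν) (φ := fun w : ℕ → Instr => w k)
      (measurable_pi_apply k).aemeasurable (f := z) (measurable_of_finite z).aestronglyMeasurable
    rw [← this, Measure.infinitePi_map_eval]
  rw [← hz]
  have hmeas : Measurable fun w : ℕ → Instr => z (w k) :=
    (measurable_of_finite z).comp (measurable_pi_apply k)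
  refine IndepFun.integral_fun_mul_eq_mul_integral ?_ hf.measurable.aestronglyMeasurable
    hmeas.aestronglyMeasurable
  obtain ⟨g, rfl⟩ := hf.exists_eq_comp
  have h1 : iIndepFun (fun (i : ℕ) (w : ℕ → Instr) => w i) (wordMeasure ν) :=
    iIndepFun_infinitePi (X := fun _ a => a) fun _ => measurable_id
  have h2 := h1.indepFun_finset (Finset.range k) {k} (by simp) fun i => measurable_pi_apply i
  exact h2.comp (φ := g) (ψ := fun y => z (y ⟨k, by simp⟩)) (measurable_of_finite _)
    (measurable_of_finite _)

variable {A : ℕ → (ℕ → Instr) → ℝ} (hA : ∀ i, DependsOnFirst i (A i)) (z : Instr → ℝ)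
include hA

/-- The first moment of a sum with predictable coefficients. -/
lemma integral_sum_mul_eval (k : ℕ) :
    ∫ w, ∑ i ∈ Finset.range k, A i w * z (w i) ∂wordMeasure ν
      = (∫ a, z a ∂ν) * ∫ w, ∑ i ∈ Finset.range k, A i w ∂wordMeasure ν := by
  rw [integral_finsetSum, integral_finsetSum, Finset.mul_sum]
  · exact Finset.sum_congr rfl fun i _ => by rw [integral_mul_eval (hA i), mul_comm]
  · exact fun i _ => (hA i).integrable
  · intro i _
    have : DependsOnFirst (i + 1) (fun w => A i w * z (w i)) := fun x y h => by
      beta_reduce; rw [((hA i).mono i.le_succ) h, h i i.lt_succ_self]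
    exact this.integrable

/-- The second moment of a sum of centered variables with predictable coefficients. -/
lemma integral_sum_mul_eval_sq (hz : ∫ a, z a ∂ν = 0) (k : ℕ) :
    ∫ w, (∑ i ∈ Finset.range k, A i w * z (w i)) ^ 2 ∂wordMeasure ν
      = (∫ a, z a ^ 2 ∂ν) * ∫ w, ∑ i ∈ Finset.range k, A i w ^ 2 ∂wordMeasure ν := by
  induction k with
  | zero => simp
  | succ k ih =>
    have hW := dependsOn_sum_mul_eval hA z k
    set W := fun w => ∑ i ∈ Finset.range k, A i w * z (w i) with hWdef
    have d1 : DependsOnFirst k (fun w => W w ^ 2) := fun x y h => by beta_reduce; rw [hW h]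
    have d2 : DependsOnFirst k (fun w => 2 * W w * A k w) := fun x y h => by
      beta_reduce; rw [hW h, hA k h]
    have d3 : DependsOnFirst k (fun w => A k w ^ 2) := fun x y h => by beta_reduce; rw [hA k h]
    have d4 : DependsOnFirst (k + 1) (fun w => 2 * W w * A k w * z (w k)) := fun x y h => by
      beta_reduce; rw [hW fun i hi => h i (by omega), (hA k) fun i hi => h i (by omega), h k k.lt_succ_self]
    have d5 : DependsOnFirst (k + 1) (fun w => A k w ^ 2 * z (w k) ^ 2) := fun x y h => by
      beta_reduce; rw [(hA k) fun i hi => h i (by omega), h k k.lt_succ_self]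
    have d6 : DependsOnFirst k (fun w => ∑ i ∈ Finset.range k, A i w ^ 2) :=
      dependsOn_sum fun i hi x y h => by rw [((hA i).mono hi.le) h]
    -- The cross term has mean zero because `z (w k)` is centred and its coefficient depends on
    -- earlier instructions only.
    have e1 : ∀ w, (∑ i ∈ Finset.range (k + 1), A i w * z (w i)) ^ 2
        = W w ^ 2 + 2 * W w * A k w * z (w k) + A k w ^ 2 * z (w k) ^ 2 := fun w => by
      rw [Finset.sum_range_succ]; simp only [hWdef]; ring
    simp_rw [e1, Finset.sum_range_succ]
    rw [integral_add_three d1.integrable d4.integrable d5.integrable, integral_mul_eval d2 z, hz,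
      integral_mul_eval d3 (fun a => z a ^ 2), ih, integral_add d6.integrable d3.integrable]
    ring

end DependsOnFirst

/-! ### Integrals over a single instruction -/

section Single

variable {ν : Measure Instr} [IsProbabilityMeasure ν] {p : ℝ}

lemma integral_instr (hp0 : 0 ≤ p) (hp1 : p ≤ 1) (hν : ∀ a, ν {a} = ENNReal.ofReal (a.prob p))
    (f : Instr → ℝ) :
    ∫ a, f a ∂ν = p * (1 - p) * f .left + p * (1 - p) * f .right + p ^ 2 * f .both
      + (1 - p) ^ 2 * f .none := by
  classical
  let _ : Fintype Instr := ⟨{.left, .right, .both, .none}, fun a => by cases a <;> simp⟩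
  have hu : (Finset.univ : Finset Instr) = {.left, .right, .both, .none} := rfl
  have hr : ∀ a, ν.real {a} = a.prob p := fun a => by
    have : 0 ≤ a.prob p := by
      cases a <;> simp only [Instr.prob]
      · exact mul_nonneg hp0 (by linarith)
      · exact mul_nonneg hp0 (by linarith)
      · positivity
      · positivity
    rw [measureReal_def, hν, ENNReal.toReal_ofReal this]
  rw [integral_fintype Integrable.of_finite, hu]
  simp [hr, Instr.prob]
  ring

/-- The displacement of the first moment by an instruction. -/
def Instr.drift (a : Instr) : ℝ := a.toRight - a.toLeft

/-- The number of particles that an instruction moves. -/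
def Instr.moved (a : Instr) : ℝ := a.toRight + a.toLeft

variable (hp0 : 0 ≤ p) (hp1 : p ≤ 1) (hν : ∀ a, ν {a} = ENNReal.ofReal (a.prob p))
include hp0 hp1 hν

lemma integral_drift : ∫ a, a.drift ∂ν = 0 := by
  rw [integral_instr hp0 hp1 hν]; simp [Instr.drift, Instr.toLeft, Instr.toRight]

/-- The numbers sent left and right are independent Bernoulli(p), so their difference and their sum
both have variance 2p(1-p). -/
lemma integral_drift_sq : ∫ a, a.drift ^ 2 ∂ν = 2 * p * (1 - p) := by
  rw [integral_instr hp0 hp1 hν]; simp [Instr.drift, Instr.toLeft, Instr.toRight]; ring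

lemma integral_moved_sub : ∫ a, (a.moved - 2 * p) ∂ν = 0 := by
  rw [integral_instr hp0 hp1 hν]; simp [Instr.moved, Instr.toLeft, Instr.toRight]; ring

lemma integral_moved_sub_sq : ∫ a, (a.moved - 2 * p) ^ 2 ∂ν = 2 * p * (1 - p) := by
  rw [integral_instr hp0 hp1 hν]; simp [Instr.moved, Instr.toLeft, Instr.toRight]; ring

end Single

/-! ### The moments of the configuration along a trajectory -/

/-- Indicator of the event that the configuration is unstable after `k` steps. -/
noncomputable def unstable (n k : ℕ) (w : ℕ → Instr) : ℝ :=
  open Classical in if Stable (traj n w k) then 0 else 1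

/-- The number of topplings in the first `k` steps. -/
noncomputable def topplings (n k : ℕ) (w : ℕ → Instr) : ℝ :=
  ∑ i ∈ Finset.range k, unstable n i w

lemma unstable_of_stable {n k : ℕ} {w : ℕ → Instr} (h : Stable (traj n w k)) :
    unstable n k w = 0 := if_pos h

lemma unstable_of_not_stable {n k : ℕ} {w : ℕ → Instr} (h : ¬ Stable (traj n w k)) :
    unstable n k w = 1 := if_neg h

lemma unstable_eq_zero_or_one (n k : ℕ) (w : ℕ → Instr) :
    unstable n k w = 0 ∨ unstable n k w = 1 := by
  by_cases h : Stable (traj n w k)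
  · exact Or.inl (unstable_of_stable h)
  · exact Or.inr (unstable_of_not_stable h)

lemma unstable_anti {n i k : ℕ} (hik : i ≤ k) {w : ℕ → Instr} (h : unstable n k w = 1) :
    unstable n i w = 1 := by
  refine unstable_of_not_stable fun hs => ?_
  rw [unstable_of_stable (by rw [traj_eq_of_stable hs hik]; exact hs)] at h
  norm_num at h

lemma dependsOn_traj (n k : ℕ) (f : (ℤ → ℕ) → ℝ) :
    DependsOnFirst k (fun w => f (traj n w k)) := fun x y h => by
  beta_reduce; rw [traj_congr h]

lemma dependsOn_unstable (n k : ℕ) : DependsOnFirst k (unstable n k) := fun x y h => by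
  rw [unstable, unstable, traj_congr h]

lemma dependsOn_topplings (n k : ℕ) : DependsOnFirst k (topplings n k) :=
  dependsOn_sum fun i hi => (dependsOn_unstable n i).mono hi.le

/-- If step `k` still finds an unstable vertex, all `k` earlier steps were topplings. -/
lemma mul_unstable_le_topplings (n k : ℕ) (w : ℕ → Instr) :
    k * unstable n k w ≤ topplings n k w := by
  rcases unstable_eq_zero_or_one n k w with h | h
  · rw [h, mul_zero]
    exact Finset.sum_nonneg fun i _ => by
      rcases unstable_eq_zero_or_one n i w with h | h <;> rw [h]; norm_num
  · rw [topplings, Finset.sum_congr rfl fun i hi =>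
      unstable_anti (Finset.mem_range.1 hi).le h, h]
    simp

lemma Reachable.moment₁_topple {n : ℕ} {η : ℤ → ℕ} (h : Reachable n η) {v : ℤ} (hv : 2 ≤ η v)
    (a : Instr) : moment₁ n (Sandpile.topple η v a) = moment₁ n η + a.drift := by
  have := h.sum_mul_topple hv a (fun x => (x : ℝ))
  rw [moment₁, moment₁, this, Instr.drift]
  push_cast; ring

/-- From (v ± 1)² - v² = ±2v + 1. -/
lemma Reachable.moment₂_topple {n : ℕ} {η : ℤ → ℕ} (h : Reachable n η) {v : ℤ} (hv : 2 ≤ η v)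
    (a : Instr) : moment₂ n (Sandpile.topple η v a) = moment₂ n η + (2 * v * a.drift + a.moved) := by
  have := h.sum_mul_topple hv a (fun x => (x : ℝ) ^ 2)
  rw [moment₂, moment₂, this, Instr.drift, Instr.moved]
  push_cast; ring

lemma Reachable.moment₂_mem {n : ℕ} {η : ℤ → ℕ} (h : Reachable n η) :
    0 ≤ moment₂ n η ∧ moment₂ n η ≤ 4 * (n : ℝ) ^ 3 := by
  constructor
  · exact Finset.sum_nonneg fun x _ => by positivity
  · have hs : (∑ x ∈ box n, (η x : ℝ)) = n := by exact_mod_cast h.sum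
    calc moment₂ n η ≤ ∑ x ∈ box n, 4 * (n : ℝ) ^ 2 * η x := by
          refine Finset.sum_le_sum fun x _ => ?_
          rcases Nat.eq_zero_or_pos (η x) with h0 | h0
          · simp [h0]
          · have := h.supp x h0
            have h1 : -(2 * n : ℝ) ≤ x := by exact_mod_cast this.1
            have h2 : (x : ℝ) ≤ 2 * n := by exact_mod_cast this.2
            refine mul_le_mul_of_nonneg_right ?_ (Nat.cast_nonneg _)
            nlinarith
      _ = 4 * (n : ℝ) ^ 3 := by rw [← Finset.mul_sum, hs]; ring

lemma moment₁_traj {n : ℕ} (hn : 0 < n) (w : ℕ → Instr) (k : ℕ) :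
    moment₁ n (traj n w k) = ∑ i ∈ Finset.range k, unstable n i w * (w i).drift := by
  induction k with
  | zero => simp [traj, moment₁, Pi.single_apply]
  | succ k ih =>
    rw [Finset.sum_range_succ, ← ih]
    by_cases h : Stable (traj n w k)
    · rw [traj, toppleLeftmost_of_stable h, unstable_of_stable h]; ring
    · have hr := reachable_traj hn w k
      rw [traj, toppleLeftmost_of_not_stable h, unstable_of_not_stable h, one_mul,
        hr.moment₁_topple (hr.one_lt_leftmostUnstable h)]

/-- The position of the toppling in step `k`, or `0` if there is none. -/
noncomputable def topplePos (n k : ℕ) (w : ℕ → Instr) : ℝ :=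
  unstable n k w * (leftmostUnstable (traj n w k) : ℤ)

lemma dependsOn_topplePos (n k : ℕ) : DependsOnFirst k (topplePos n k) := fun x y h => by
  rw [topplePos, topplePos, dependsOn_unstable n k h, traj_congr h]

lemma topplePos_sq_le {n : ℕ} (hn : 0 < n) (k : ℕ) (w : ℕ → Instr) :
    topplePos n k w ^ 2 ≤ 4 * (n : ℝ) ^ 2 * unstable n k w := by
  by_cases h : Stable (traj n w k)
  · simp [topplePos, unstable_of_stable h]
  · have hr := reachable_traj hn w k
    have := hr.supp _ (lt_trans one_pos (hr.one_lt_leftmostUnstable h))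
    have h1 : -(2 * n : ℝ) ≤ (leftmostUnstable (traj n w k) : ℤ) := by exact_mod_cast this.1
    have h2 : ((leftmostUnstable (traj n w k) : ℤ) : ℝ) ≤ 2 * n := by exact_mod_cast this.2
    rw [topplePos, unstable_of_not_stable h]
    nlinarith

lemma moment₂_traj {n : ℕ} (hn : 0 < n) (w : ℕ → Instr) (k : ℕ) :
    moment₂ n (traj n w k) = 2 * ∑ i ∈ Finset.range k, topplePos n i w * (w i).drift
      + ∑ i ∈ Finset.range k, unstable n i w * (w i).moved := by
  induction k with
  | zero => simp [traj, moment₂, Pi.single_apply]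
  | succ k ih =>
    rw [Finset.sum_range_succ, Finset.sum_range_succ, topplePos]
    by_cases h : Stable (traj n w k)
    · rw [traj, toppleLeftmost_of_stable h, unstable_of_stable h, ih]; ring
    · have hr := reachable_traj hn w k
      rw [traj, toppleLeftmost_of_not_stable h, unstable_of_not_stable h, one_mul,
        hr.moment₂_topple (hr.one_lt_leftmostUnstable h), ih]
      ring

lemma unstable_sq (n k : ℕ) (w : ℕ → Instr) : unstable n k w ^ 2 = unstable n k w := by
  rcases unstable_eq_zero_or_one n k w with h | h <;> rw [h] <;> norm_num

/-- Instability holds on an initial segment of times, so the summands are the indicator of the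
symmetric difference of two initial segments. This identifies the quadratic variation of M₁ minus
the sum of `t` drifts. -/
lemma abs_topplings_sub {n t k : ℕ} (htk : t ≤ k) (w : ℕ → Instr) :
    ∑ i ∈ Finset.range k, (unstable n i w - if i < t then 1 else 0) ^ 2
      = |topplings n k w - t| := by
  have ht : (t : ℝ) = ∑ i ∈ Finset.range k, if i < t then (1 : ℝ) else 0 := by
    rw [← Finset.sum_filter, Finset.sum_const, nsmul_one]
    congr 1
    have : (Finset.range k).filter (· < t) = Finset.range t := by
      ext i; simp; omega
    rw [this, Finset.card_range]
  rw [topplings, ht, ← Finset.sum_sub_distrib]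
  -- Depending on whether time `t` is still unstable, all differences have the same sign.
  rcases unstable_eq_zero_or_one n t w with h | h
  · rw [← abs_neg, ← Finset.sum_neg_distrib, abs_of_nonneg]
    · refine Finset.sum_congr rfl fun i _ => ?_
      split_ifs with hi <;> rcases unstable_eq_zero_or_one n i w with h1 | h1
      · rw [h1]; norm_num
      · rw [h1]; norm_num
      · rw [h1]; norm_num
      · have := unstable_anti (not_lt.1 hi) h1
        rw [h] at this; norm_num at this
    · refine Finset.sum_nonneg fun i _ => ?_
      split_ifs with hi <;> rcases unstable_eq_zero_or_one n i w with h1 | h1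
      · rw [h1]; norm_num
      · rw [h1]; norm_num
      · rw [h1]; norm_num
      · have := unstable_anti (not_lt.1 hi) h1
        rw [h] at this; norm_num at this
  · have hn : ∀ i ∈ Finset.range k, 0 ≤ unstable n i w - if i < t then 1 else 0 := fun i _ => by
      split_ifs with hi
      · rw [unstable_anti hi.le h]; norm_num
      · rcases unstable_eq_zero_or_one n i w with h1 | h1 <;> rw [h1] <;> norm_num
    rw [abs_of_nonneg (Finset.sum_nonneg hn)]
    refine Finset.sum_congr rfl fun i _ => ?_
    split_ifs with hi
    · rw [unstable_anti hi.le h]; norm_num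
    · rw [sub_zero, unstable_sq]

/-! ### Moment estimates -/

section Moments

variable {ν : Measure Instr} [IsProbabilityMeasure ν] {p : ℝ} (hp0 : 0 < p) (hp1 : p < 1)
  (hν : ∀ a, ν {a} = ENNReal.ofReal (a.prob p)) {n : ℕ} (hn : 0 < n)
include hp0 hp1 hν hn

/-- Taking expectations, E M₂ = 2p E T, while M₂ ≤ 4n³ because all particles lie in [-2n, 2n]. -/
lemma integral_topplings_le (k : ℕ) :
    p * ∫ w, topplings n k w ∂wordMeasure ν ≤ 2 * (n : ℝ) ^ 3 := by
  have h1 := integral_sum_mul_eval (ν := ν) (dependsOn_topplePos n) Instr.drift k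
  have h2 := integral_sum_mul_eval (ν := ν) (dependsOn_unstable n)
    (fun a => a.moved - 2 * p) k
  rw [integral_drift hp0.le hp1.le hν, zero_mul] at h1
  rw [integral_moved_sub hp0.le hp1.le hν, zero_mul] at h2
  have i1 := (dependsOn_sum_mul_eval (dependsOn_topplePos n) Instr.drift k).integrable (ν := ν)
  have i2 := (dependsOn_sum_mul_eval (dependsOn_unstable n)
    (fun a => a.moved - 2 * p) k).integrable (ν := ν)
  have i3 := (dependsOn_topplings n k).integrable (ν := ν)
  have h3 : ∫ w, moment₂ n (traj n w k) ∂wordMeasure ν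
      = 2 * p * ∫ w, topplings n k w ∂wordMeasure ν := by
    have : ∀ w, moment₂ n (traj n w k)
        = 2 * ∑ i ∈ Finset.range k, topplePos n i w * (w i).drift
          + ∑ i ∈ Finset.range k, unstable n i w * ((w i).moved - 2 * p)
          + 2 * p * topplings n k w := fun w => by
      rw [moment₂_traj hn, topplings, Finset.mul_sum (a := 2 * p), add_assoc,
        ← Finset.sum_add_distrib]
      congr 1
      exact Finset.sum_congr rfl fun i _ => by ring
    simp_rw [this]
    rw [integral_add_three (i1.const_mul 2) i2 (i3.const_mul _), integral_const_mul, integral_const_mul, h1, h2]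
    ring
  have h4 : ∫ w, moment₂ n (traj n w k) ∂wordMeasure ν ≤ 4 * (n : ℝ) ^ 3 := by
    have := integral_mono ((dependsOn_traj n k (moment₂ n)).integrable (ν := ν))
      (integrable_const (4 * (n : ℝ) ^ 3)) fun w => (reachable_traj hn w k).moment₂_mem.2
    simpa using this
  linarith

lemma integral_unstable_le (k : ℕ) :
    p * (k * ∫ w, unstable n k w ∂wordMeasure ν) ≤ 2 * (n : ℝ) ^ 3 := by
  refine le_trans ?_ (integral_topplings_le hp0 hp1 hν hn k)
  rw [← integral_const_mul]
  exact mul_le_mul_of_nonneg_left (integral_mono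
    (((dependsOn_unstable n k).integrable).const_mul _) (dependsOn_topplings n k).integrable
    (mul_unstable_le_topplings n k)) hp0.le

lemma integral_moment₁_sq_le (k : ℕ) :
    ∫ w, moment₁ n (traj n w k) ^ 2 ∂wordMeasure ν ≤ 4 * (n : ℝ) ^ 3 := by
  have h := integral_sum_mul_eval_sq (ν := ν) (dependsOn_unstable n) Instr.drift
    (integral_drift hp0.le hp1.le hν) k
  simp_rw [← moment₁_traj hn, unstable_sq] at h
  rw [h, integral_drift_sq hp0.le hp1.le hν]
  have h1 := integral_topplings_le hp0 hp1 hν hn k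
  have h0 : 0 ≤ p * ∫ w, topplings n k w ∂wordMeasure ν :=
    mul_nonneg hp0.le (integral_nonneg fun w => Finset.sum_nonneg fun i _ => by
      rcases unstable_eq_zero_or_one n i w with h | h <;> rw [h]; norm_num)
  change 2 * p * (1 - p) * ∫ w, topplings n k w ∂wordMeasure ν ≤ _
  nlinarith

/-- The difference is 2D + E with D, E centred sums. Positions are at most 2n, so E[D²] ≤ 16n⁵, and
E[E²] ≤ 4n³ ≤ 4n⁵; the constant is 8·16 + 2·4. -/
lemma integral_moment₂_sub_sq_le (k : ℕ) :
    ∫ w, (moment₂ n (traj n w k) - 2 * p * topplings n k w) ^ 2 ∂wordMeasure ν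
      ≤ 136 * (n : ℝ) ^ 5 := by
  have h1 := integral_sum_mul_eval_sq (ν := ν) (dependsOn_topplePos n) Instr.drift
    (integral_drift hp0.le hp1.le hν) k
  have h2 := integral_sum_mul_eval_sq (ν := ν) (dependsOn_unstable n)
    (fun a => a.moved - 2 * p) (integral_moved_sub hp0.le hp1.le hν) k
  simp_rw [unstable_sq] at h2
  rw [integral_drift_sq hp0.le hp1.le hν] at h1
  rw [integral_moved_sub_sq hp0.le hp1.le hν] at h2
  set D := fun w : ℕ → Instr => ∑ i ∈ Finset.range k, topplePos n i w * (w i).drift with hD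
  set E := fun w : ℕ → Instr =>
    ∑ i ∈ Finset.range k, unstable n i w * ((w i).moved - 2 * p) with hE
  have dD : DependsOnFirst k D := dependsOn_sum_mul_eval (dependsOn_topplePos n) Instr.drift k
  have dE : DependsOnFirst k E := dependsOn_sum_mul_eval (dependsOn_unstable n)
    (fun a => a.moved - 2 * p) k
  have dD2 : DependsOnFirst k (fun w => D w ^ 2) := fun x y h => by beta_reduce; rw [dD h]
  have dE2 : DependsOnFirst k (fun w => E w ^ 2) := fun x y h => by beta_reduce; rw [dE h]
  have dDE2 : DependsOnFirst k (fun w => (2 * D w + E w) ^ 2) := fun x y h => by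
    beta_reduce; rw [dD h, dE h]
  have heq : ∀ w, moment₂ n (traj n w k) - 2 * p * topplings n k w = 2 * D w + E w := fun w => by
    rw [moment₂_traj hn, topplings, Finset.mul_sum (a := 2 * p), add_sub_assoc,
      ← Finset.sum_sub_distrib]
    simp only [hD, hE]
    congr 1
    exact Finset.sum_congr rfl fun i _ => by ring
  have hT := integral_topplings_le hp0 hp1 hν hn k
  have hT0 : 0 ≤ ∫ w, topplings n k w ∂wordMeasure ν :=
    integral_nonneg fun w => Finset.sum_nonneg fun i _ => by
      rcases unstable_eq_zero_or_one n i w with h | h <;> rw [h]; norm_num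
  set τ := ∫ w, topplings n k w ∂wordMeasure ν with hτ
  have hpos : ∫ w, ∑ i ∈ Finset.range k, topplePos n i w ^ 2 ∂wordMeasure ν
      ≤ 4 * (n : ℝ) ^ 2 * τ := by
    rw [hτ, ← integral_const_mul]
    refine integral_mono (DependsOnFirst.integrable (k := k) (dependsOn_sum fun i hi x y h => ?_))
      ((dependsOn_topplings n k).integrable.const_mul _) fun w => ?_
    · rw [((dependsOn_topplePos n i).mono hi.le) h]
    · simp only [topplings, Finset.mul_sum]
      exact Finset.sum_le_sum fun i _ => topplePos_sq_le hn i w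
  have hDb : ∫ w, D w ^ 2 ∂wordMeasure ν ≤ 16 * (n : ℝ) ^ 5 := by
    have e : ∫ w, D w ^ 2 ∂wordMeasure ν
      = 2 * p * (1 - p) * ∫ w, ∑ i ∈ Finset.range k, topplePos n i w ^ 2 ∂wordMeasure ν := h1
    rw [e]
    calc _ ≤ 2 * p * (1 - p) * (4 * (n : ℝ) ^ 2 * τ) :=
          mul_le_mul_of_nonneg_left hpos (by nlinarith)
      _ = 8 * (n : ℝ) ^ 2 * ((1 - p) * (p * τ)) := by ring
      _ ≤ 8 * (n : ℝ) ^ 2 * (2 * (n : ℝ) ^ 3) := by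
          refine mul_le_mul_of_nonneg_left ?_ (by positivity)
          have : 0 ≤ p * τ := mul_nonneg hp0.le hT0
          nlinarith
      _ = 16 * (n : ℝ) ^ 5 := by ring
  have hEb : ∫ w, E w ^ 2 ∂wordMeasure ν ≤ 4 * (n : ℝ) ^ 5 := by
    have e : ∫ w, E w ^ 2 ∂wordMeasure ν = 2 * p * (1 - p) * τ := h2
    rw [e]
    have : 0 ≤ p * τ := mul_nonneg hp0.le hT0
    have h35 : (n : ℝ) ^ 3 ≤ (n : ℝ) ^ 5 :=
      pow_le_pow_right₀ (by exact_mod_cast hn) (by norm_num)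
    nlinarith
  simp_rw [heq]
  calc ∫ w, (2 * D w + E w) ^ 2 ∂wordMeasure ν
      ≤ ∫ w, (8 * D w ^ 2 + 2 * E w ^ 2) ∂wordMeasure ν :=
        integral_mono dDE2.integrable ((dD2.integrable.const_mul 8).add (dE2.integrable.const_mul 2))
          fun w => by nlinarith [sq_nonneg (2 * D w - E w)]
    _ = 8 * ∫ w, D w ^ 2 ∂wordMeasure ν + 2 * ∫ w, E w ^ 2 ∂wordMeasure ν := by
        rw [integral_add (dD2.integrable.const_mul 8) (dE2.integrable.const_mul 2),
          integral_const_mul, integral_const_mul]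
    _ ≤ 136 * (n : ℝ) ^ 5 := by linarith

/-- On the stable event M₂ is n³/12 up to 4M₁²/n + 6n²; the unstable event costs at most 4n³ with
probability at most 1/n. With E[M₁²] ≤ 4n³ this sums to 16 + 6 + 4 = 26. -/
lemma integral_abs_moment₂_sub_le {k : ℕ}
    (hk : ∫ w, unstable n k w ∂wordMeasure ν ≤ 1 / n) :
    ∫ w, |moment₂ n (traj n w k) - (n : ℝ) ^ 3 / 12| ∂wordMeasure ν ≤ 26 * (n : ℝ) ^ 2 := by
  have hn' : (0 : ℝ) < n := by exact_mod_cast hn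
  have hn1 : (1 : ℝ) ≤ n := by exact_mod_cast hn
  have hb : ∀ w, |moment₂ n (traj n w k) - (n : ℝ) ^ 3 / 12|
      ≤ 4 / n * moment₁ n (traj n w k) ^ 2 + 6 * (n : ℝ) ^ 2
        + 4 * (n : ℝ) ^ 3 * unstable n k w := fun w => by
    have hr := reachable_traj hn w k
    by_cases h : Stable (traj n w k)
    · refine (hr.moments_of_stable hn h).2.2.trans ?_
      rw [unstable_of_stable h]
      have h1 : 4 / (n : ℝ) * moment₁ n (traj n w k) ^ 2
          = 2 * n * (2 * (|moment₁ n (traj n w k)| / n) ^ 2) := by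
        rw [div_pow, sq_abs]; field_simp; ring
      rw [h1]
      nlinarith [sq_nonneg (|moment₁ n (traj n w k)| / n - 1 / 2), mul_nonneg hn'.le
        (sq_nonneg (|moment₁ n (traj n w k)| / n - 1 / 2))]
    · rw [unstable_of_not_stable h]
      have h1 := hr.moment₂_mem
      have h2 : 0 ≤ 4 / (n : ℝ) * moment₁ n (traj n w k) ^ 2 := by positivity
      have h3 : 0 ≤ (n : ℝ) ^ 3 := by positivity
      have h4 : 0 ≤ (n : ℝ) ^ 2 := by positivity
      rw [abs_le]; constructor <;> linarith
  have i1 := (dependsOn_traj n k (fun η => moment₁ n η ^ 2)).integrable (ν := ν)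
  have i2 := (dependsOn_unstable n k).integrable (ν := ν)
  have i3 := (dependsOn_traj n k (fun η => |moment₂ n η - (n : ℝ) ^ 3 / 12|)).integrable (ν := ν)
  have h1 := integral_mono i3
    (((i1.const_mul (4 / (n : ℝ))).add (integrable_const (6 * (n : ℝ) ^ 2))).add
      (i2.const_mul (4 * (n : ℝ) ^ 3))) hb
  have h2 := integral_moment₁_sq_le hp0 hp1 hν hn k
  refine h1.trans ?_
  simp only [Pi.add_apply]
  rw [integral_add_three (i1.const_mul _) (integrable_const _) (i2.const_mul _), integral_const_mul, integral_const_mul,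
    integral_const_mul]
  simp only [integral_const, probReal_univ, one_smul]
  have h3 : 4 / (n : ℝ) * ∫ w, moment₁ n (traj n w k) ^ 2 ∂wordMeasure ν ≤ 16 * (n : ℝ) ^ 2 := by
    calc _ ≤ 4 / (n : ℝ) * (4 * (n : ℝ) ^ 3) := mul_le_mul_of_nonneg_left h2 (by positivity)
      _ = 16 * (n : ℝ) ^ 2 := by field_simp; ring
  have h4 : 4 * (n : ℝ) ^ 3 * ∫ w, unstable n k w ∂wordMeasure ν ≤ 4 * (n : ℝ) ^ 2 := by
    calc _ ≤ 4 * (n : ℝ) ^ 3 * (1 / n) := mul_le_mul_of_nonneg_left hk (by positivity)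
      _ = 4 * (n : ℝ) ^ 2 := by field_simp
  linarith

/-- The first moment of the configuration is close to the sum of the first `n ^ 3 / (24 p)`
drifts. -/
lemma integral_moment₁_sub_sq_le {k : ℕ}
    (hk : ∫ w, unstable n k w ∂wordMeasure ν ≤ 1 / n) (htk : ⌊(n : ℝ) ^ 3 / (24 * p)⌋₊ ≤ k) :
    ∫ w, (moment₁ n (traj n w k)
        - ∑ i ∈ Finset.range ⌊(n : ℝ) ^ 3 / (24 * p)⌋₊, (w i).drift) ^ 2 ∂wordMeasure ν
      ≤ (69 * (n ^ 2 * √n) + 26 * (n : ℝ) ^ 2) / (2 * p) + 1 := by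
  have hn' : (0 : ℝ) < n := by exact_mod_cast hn
  set t := ⌊(n : ℝ) ^ 3 / (24 * p)⌋₊ with ht
  -- The difference of the two sums of drifts is again a sum with predictable coefficients, so its
  -- second moment is computed by orthogonality.
  set A : ℕ → (ℕ → Instr) → ℝ := fun i w => unstable n i w - if i < t then 1 else 0 with hA
  have dA : ∀ i, DependsOnFirst i (A i) := fun i x y h => by
    simp only [hA]; rw [dependsOn_unstable n i h]
  have hsq := integral_sum_mul_eval_sq (ν := ν) dA Instr.drift (integral_drift hp0.le hp1.le hν) k
  have hdiff : ∀ w : ℕ → Instr, ∑ i ∈ Finset.range k, A i w * (w i).drift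
      = moment₁ n (traj n w k) - ∑ i ∈ Finset.range t, (w i).drift := fun w => by
    rw [moment₁_traj hn]
    have : ∑ i ∈ Finset.range t, (w i).drift
        = ∑ i ∈ Finset.range k, (if i < t then 1 else 0) * (w i).drift := by
      simp_rw [ite_mul, one_mul, zero_mul]
      rw [← Finset.sum_filter]
      congr 1
      ext i; simp; omega
    rw [this, ← Finset.sum_sub_distrib]
    exact Finset.sum_congr rfl fun i _ => by simp only [hA]; ring
  simp_rw [hdiff, hA, abs_topplings_sub htk] at hsq
  rw [hsq, integral_drift_sq hp0.le hp1.le hν]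
  set Q := fun w => moment₂ n (traj n w k) - 2 * p * topplings n k w with hQ
  have dQ : DependsOnFirst k Q := fun x y h => by
    simp only [hQ]; rw [traj_congr h, dependsOn_topplings n k h]
  have dQ2 : DependsOnFirst k (fun w => Q w ^ 2) := fun x y h => by beta_reduce; rw [dQ h]
  have dT : DependsOnFirst k (fun w => |topplings n k w - t|) := fun x y h => by
    beta_reduce; rw [dependsOn_topplings n k h]
  have i3 := (dependsOn_traj n k (fun η => |moment₂ n η - (n : ℝ) ^ 3 / 12|)).integrable (ν := ν)
  -- The scale n^{5/2} of Q balances the inequality |Q| ≤ Q²/(2λ) + λ/2.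
  set lam : ℝ := n ^ 2 * √n with hlam
  have hlam0 : 0 < lam := by positivity
  have hlam2 : lam * lam = (n : ℝ) ^ 5 := by
    rw [hlam]
    calc _ = (n : ℝ) ^ 4 * (√n * √n) := by ring
      _ = _ := by rw [Real.mul_self_sqrt hn'.le]; ring
  have hb : ∀ w, |topplings n k w - t| ≤ 1 / (2 * p) * (1 / (2 * lam) * Q w ^ 2
      + |moment₂ n (traj n w k) - (n : ℝ) ^ 3 / 12|) + (lam / 2 / (2 * p) + 1) := fun w => by
    have h1 : |(t : ℝ) - (n : ℝ) ^ 3 / (24 * p)| ≤ 1 := by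
      have := Nat.floor_le (a := (n : ℝ) ^ 3 / (24 * p)) (by positivity)
      have := Nat.lt_floor_add_one ((n : ℝ) ^ 3 / (24 * p))
      rw [abs_le]; constructor <;> linarith
    have h2 : |Q w| ≤ 1 / (2 * lam) * Q w ^ 2 + lam / 2 := by
      have : 1 / (2 * lam) * Q w ^ 2 + lam / 2 - |Q w| = (|Q w| - lam) ^ 2 / (2 * lam) := by
        rw [← sq_abs (Q w)]; field_simp; ring
      have h3 : 0 ≤ (|Q w| - lam) ^ 2 / (2 * lam) := by positivity
      linarith
    have h3 : topplings n k w - t = 1 / (2 * p) * (-Q w)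
        + 1 / (2 * p) * (moment₂ n (traj n w k) - (n : ℝ) ^ 3 / 12)
        + -(t - (n : ℝ) ^ 3 / (24 * p)) := by
      simp only [hQ]; field_simp; ring
    have h4 : (0 : ℝ) ≤ 1 / (2 * p) := by positivity
    rw [h3]
    refine (abs_add_three _ _ _).trans ?_
    rw [abs_mul, abs_mul, abs_neg, abs_neg, abs_of_nonneg h4]
    have h5 := mul_le_mul_of_nonneg_left h2 h4
    have h6 : lam / 2 / (2 * p) = 1 / (2 * p) * (lam / 2) := by ring
    rw [h6]
    linarith
  have hb' : ∀ w, |topplings n k w - t| ≤ 1 / (2 * p) * (1 / (2 * lam)) * Q w ^ 2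
      + 1 / (2 * p) * |moment₂ n (traj n w k) - (n : ℝ) ^ 3 / 12| + (lam / 2 / (2 * p) + 1) :=
    fun w => (hb w).trans_eq (by ring)
  have j1 := dQ2.integrable (ν := ν).const_mul (1 / (2 * p) * (1 / (2 * lam)))
  have j2 := i3.const_mul (1 / (2 * p))
  have j3 := integrable_const (μ := wordMeasure ν) (lam / 2 / (2 * p) + 1)
  have h1 : ∫ w, |topplings n k w - t| ∂wordMeasure ν
      ≤ ∫ w, (1 / (2 * p) * (1 / (2 * lam)) * Q w ^ 2
        + 1 / (2 * p) * |moment₂ n (traj n w k) - (n : ℝ) ^ 3 / 12|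
        + (lam / 2 / (2 * p) + 1)) ∂wordMeasure ν :=
    integral_mono dT.integrable ((j1.add j2).add j3) hb'
  rw [integral_add_three j1 j2 j3, integral_const_mul, integral_const_mul, mul_assoc,
    ← mul_add] at h1
  simp only [integral_const, probReal_univ, one_smul] at h1
  have h2 := integral_moment₂_sub_sq_le hp0 hp1 hν hn k
  have h3 := integral_abs_moment₂_sub_le hp0 hp1 hν hn hk
  have h4 : 1 / (2 * lam) * ∫ w, Q w ^ 2 ∂wordMeasure ν ≤ 68 * lam := by
    calc _ ≤ 1 / (2 * lam) * (136 * (n : ℝ) ^ 5) := mul_le_mul_of_nonneg_left h2 (by positivity)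
      _ = 68 * lam := by rw [← hlam2]; field_simp; ring
  have h5 : ∫ w, |topplings n k w - t| ∂wordMeasure ν
      ≤ (69 * lam + 26 * (n : ℝ) ^ 2) / (2 * p) + 1 := by
    refine h1.trans ?_
    have h6 : 1 / (2 * p) * (1 / (2 * lam) * ∫ w, Q w ^ 2 ∂wordMeasure ν
        + ∫ w, |moment₂ n (traj n w k) - (n : ℝ) ^ 3 / 12| ∂wordMeasure ν)
        ≤ 1 / (2 * p) * (68 * lam + 26 * (n : ℝ) ^ 2) :=
      mul_le_mul_of_nonneg_left (by linarith) (by positivity)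
    have h7 : (69 * lam + 26 * (n : ℝ) ^ 2) / (2 * p)
        = 1 / (2 * p) * (68 * lam + 26 * (n : ℝ) ^ 2) + lam / 2 / (2 * p) + lam / 2 / (2 * p) := by
      ring
    have h8 : 0 ≤ lam / 2 / (2 * p) := by positivity
    linarith
  have h6 : 0 ≤ ∫ w, |topplings n k w - t| ∂wordMeasure ν := integral_nonneg fun w => abs_nonneg _
  have h7 : 2 * p * (1 - p) ≤ 1 := by nlinarith [sq_nonneg (2 * p - 1)]
  have h8 := mul_le_mul_of_nonneg_right h7 h6
  linarith

/-- Instability at time k has probability O(n³/(pk)), so a late deterministic time replaces the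
stabilization time. -/
lemma exists_integral_unstable_le (t : ℕ) {ε : ℝ} (hε : 0 < ε) :
    ∃ k, t ≤ k ∧ ∫ w, unstable n k w ∂wordMeasure ν ≤ ε := by
  obtain ⟨k, hk⟩ := exists_nat_ge (2 * (n : ℝ) ^ 3 / (p * ε))
  refine ⟨max t (k + 1), le_max_left _ _, ?_⟩
  have h := integral_unstable_le hp0 hp1 hν hn (max t (k + 1))
  have h1 : (k : ℝ) + 1 ≤ ((max t (k + 1) : ℕ) : ℝ) := by exact_mod_cast le_max_right t (k + 1)
  have h2 : (2 * (n : ℝ) ^ 3) ≤ k * (p * ε) := (div_le_iff₀ (by positivity)).1 hk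
  by_contra hc
  rw [not_le] at hc
  have hk0 : (0 : ℝ) ≤ k := Nat.cast_nonneg k
  have h3 : p * ((k + 1) * ε) ≤ p * (((max t (k + 1) : ℕ) : ℝ) *
      ∫ w, unstable n (max t (k + 1)) w ∂wordMeasure ν) :=
    mul_le_mul_of_nonneg_left (mul_le_mul h1 hc.le hε.le (by positivity)) hp0.le
  have h4 : 0 < p * ε := by positivity
  nlinarith

omit hn in
/-- Almost surely the configuration becomes stable. -/
lemma ae_exists_stable (n : ℕ) : ∀ᵐ w ∂wordMeasure ν, ∃ k, Stable (traj n w k) := by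
  rcases Nat.eq_zero_or_pos n with rfl | hn
  · exact Eventually.of_forall fun w => ⟨0, fun v => by simp [traj]⟩
  rw [ae_iff]
  have key : ∀ ε : ℝ, 0 < ε → (wordMeasure ν).real {w | ¬ ∃ k, Stable (traj n w k)} ≤ ε := by
    intro ε hε
    obtain ⟨k, -, hk⟩ := exists_integral_unstable_le hp0 hp1 hν hn 0 hε
    refine le_trans ?_ hk
    have h1 := mul_meas_ge_le_integral_of_nonneg (μ := wordMeasure ν) (f := unstable n k)
      (Eventually.of_forall fun w => by
        rcases unstable_eq_zero_or_one n k w with h | h <;> simp [h])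
      (dependsOn_unstable n k).integrable 1
    rw [one_mul] at h1
    refine le_trans (measureReal_mono fun w hw => ?_) h1
    simp only [Set.mem_ofPred_eq, not_exists] at hw ⊢
    rw [unstable_of_not_stable (hw k)]
  have h0 : (wordMeasure ν).real {w | ¬ ∃ k, Stable (traj n w k)} = 0 :=
    le_antisymm (le_of_forall_pos_le_add fun ε hε => by simpa using key ε hε) measureReal_nonneg
  exact (measureReal_eq_zero_iff).1 h0

end Moments

/-! ### The final configuration -/

/-- The final configuration of the trajectory driven by a sequence of instructions. -/
noncomputable def finalTraj (n : ℕ) (w : ℕ → Instr) : ℤ → ℕ :=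
  traj n w (sInf {k | Stable (traj n w k)})

lemma finalTraj_eq {n k : ℕ} {w : ℕ → Instr} (h : Stable (traj n w k)) :
    finalTraj n w = traj n w k := by
  have h1 : Stable (traj n w (sInf {k | Stable (traj n w k)})) :=
    Nat.sInf_mem (s := {k | Stable (traj n w k)}) ⟨k, h⟩
  exact (traj_eq_of_stable h1 (Nat.sInf_le h)).symm

lemma finalConfig_eq (s : ℤ → ℕ → Instr) (n : ℕ) :
    finalConfig s n = finalTraj n (word s n) := by
  simp only [finalConfig, stabTime, finalTraj, config_eq_traj]

/-! ### Central limit theorem and transfer to the final configuration -/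

lemma tendsto_cube_atTop : Tendsto (fun n : ℕ => (n : ℝ) ^ 3) atTop atTop :=
  (tendsto_pow_atTop (by norm_num)).comp tendsto_natCast_atTop_atTop

lemma tendsto_sqrt_floor_div {p : ℝ} (hp0 : 0 < p) :
    Tendsto (fun n : ℕ => √(⌊(n : ℝ) ^ 3 / (24 * p)⌋₊ : ℝ) / (n * √n)) atTop
      (𝓝 (√(24 * p))⁻¹) := by
  have h1 : Tendsto (fun n : ℕ => (⌊(24 * p)⁻¹ * (n : ℝ) ^ 3⌋₊ : ℝ) / (n : ℝ) ^ 3) atTop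
      (𝓝 (24 * p)⁻¹) :=
    (tendsto_nat_floor_mul_div_atTop (by positivity : (0 : ℝ) ≤ (24 * p)⁻¹)).comp tendsto_cube_atTop
  have h2 := (Real.continuous_sqrt.tendsto _).comp h1
  rw [Real.sqrt_inv] at h2
  refine h2.congr fun n => ?_
  have h3 : √((n : ℝ) ^ 3) = n * √n := by
    rw [show (n : ℝ) ^ 3 = n ^ 2 * n by ring, Real.sqrt_mul (by positivity),
      Real.sqrt_sq (by positivity)]
  simp only [Function.comp_apply]
  rw [Real.sqrt_div (by positivity), h3, div_eq_inv_mul ((n : ℝ) ^ 3)]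

section Limit

variable {ν : Measure Instr} [IsProbabilityMeasure ν] {p : ℝ} (hp0 : 0 < p) (hp1 : p < 1)
  (hν : ∀ a, ν {a} = ENNReal.ofReal (a.prob p))
include hp0 hp1 hν

/-- The functional is the almost sure limit of an eventually constant sequence of measurable
functions. -/
lemma aemeasurable_finalTraj (n : ℕ) (G : (ℤ → ℕ) → ℝ) :
    AEMeasurable (fun w => G (finalTraj n w)) (wordMeasure ν) := by
  refine aemeasurable_of_tendsto_metrizable_ae atTop (f := fun k w => G (traj n w k))
    (fun k => (dependsOn_traj n k G).measurable.aemeasurable) ?_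
  filter_upwards [ae_exists_stable hp0 hp1 hν n] with w ⟨k, hk⟩
  refine tendsto_const_nhds.congr' ?_
  filter_upwards [eventually_ge_atTop k] with l hl
  rw [finalTraj_eq hk, traj_eq_of_stable hk hl]

omit [IsProbabilityMeasure ν] hp0 hp1 hν in
lemma measurable_drift (i : ℕ) : Measurable fun w : ℕ → Instr => (w i).drift :=
  (measurable_of_finite Instr.drift).comp (measurable_pi_apply i)

omit hp0 hp1 hν in
lemma identDistrib_drift (i : ℕ) : IdentDistrib (fun w : ℕ → Instr => (w i).drift)
    (fun w => (w 0).drift) (wordMeasure ν) (wordMeasure ν) := by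
  have hdm : Measurable Instr.drift := measurable_of_finite _
  have hlaw : ∀ i : ℕ, (wordMeasure ν).map (fun w : ℕ → Instr => (w i).drift)
      = ν.map Instr.drift := fun i => by
    have := Measure.map_map (μ := wordMeasure ν) hdm (measurable_pi_apply i)
    rw [Measure.infinitePi_map_eval] at this
    exact this.symm
  exact ⟨(measurable_drift i).aemeasurable, (measurable_drift 0).aemeasurable,
    by rw [hlaw, hlaw]⟩

omit hp0 hp1 hν in
lemma iIndepFun_drift :
    iIndepFun (fun (i : ℕ) (w : ℕ → Instr) => (w i).drift) (wordMeasure ν) :=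
  iIndepFun_infinitePi (X := fun _ => Instr.drift) fun _ => measurable_of_finite _

omit hp0 hp1 hν in
lemma integral_eval_zero (z : Instr → ℝ) :
    ∫ w : ℕ → Instr, z (w 0) ∂wordMeasure ν = ∫ a, z a ∂ν := by
  have hone : DependsOnFirst 0 fun _ : ℕ → Instr => (1 : ℝ) := fun _ _ _ => rfl
  simpa using integral_mul_eval (ν := ν) hone z

lemma variance_drift :
    Var[fun w : ℕ → Instr => (w 0).drift; wordMeasure ν] = 2 * p * (1 - p) := by
  rw [variance_eq_integral (measurable_drift 0).aemeasurable,
    integral_eval_zero Instr.drift, integral_drift hp0.le hp1.le hν]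
  simp_rw [sub_zero]
  rw [integral_eval_zero (fun a => a.drift ^ 2), integral_drift_sq hp0.le hp1.le hν]

omit hp0 hp1 hν in
lemma memLp_drift : MemLp (fun w : ℕ → Instr => (w 0).drift) 2 (wordMeasure ν) :=
  (memLp_two_iff_integrable_sq (measurable_drift 0).aestronglyMeasurable).2
    (DependsOnFirst.integrable (k := 1)
      (dependsOn_comp_eval (fun a => a.drift ^ 2) one_pos))

omit hp0 hp1 hν [IsProbabilityMeasure ν] in
-- As 24p · (1-p)/12 = 2p(1-p), the limit of the normalized sum is written so that the later factor
-- (24p)^{-1/2} turns it into the identity.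
lemma hasLaw_sqrt_mul {p : ℝ} (hp0 : 0 < p) (hp1 : p < 1) : HasLaw (fun x : ℝ => √(24 * p) * x)
    (gaussianReal 0 (2 * p * (1 - p)).toNNReal)
    (gaussianReal 0 (Real.toNNReal ((1 - p) / 12))) := by
  have h := gaussianReal_const_mul
    (HasLaw.id (μ := gaussianReal 0 (Real.toNNReal ((1 - p) / 12)))) (√(24 * p))
  rw [mul_zero] at h
  have h1 : 0 ≤ 1 - p := by linarith
  have h2 : (2 * p * (1 - p)).toNNReal
      = NNReal.mk (√(24 * p) ^ 2) (sq_nonneg _) * ((1 - p) / 12).toNNReal := by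
    ext
    simp only [NNReal.coe_mul, NNReal.coe_mk]
    rw [Real.coe_toNNReal _ (by positivity), Real.coe_toNNReal _ (by positivity),
      Real.sq_sqrt (by positivity)]
    ring
  rw [h2]
  exact h

/-- The central limit theorem for the drifts. -/
lemma tendstoInDistribution_inv_sqrt_mul_sum_drift :
    TendstoInDistribution
      (fun (m : ℕ) (w : ℕ → Instr) => (√(m : ℝ))⁻¹ * ∑ i ∈ Finset.range m, (w i).drift) atTop
      (fun x : ℝ => √(24 * p) * x) (fun _ => wordMeasure ν)
      (gaussianReal 0 (Real.toNNReal ((1 - p) / 12))) := by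
  have hY := hasLaw_sqrt_mul hp0 hp1
  rw [← variance_drift hp0 hp1 hν] at hY
  have hclt := tendstoInDistribution_inv_sqrt_mul_sum_sub
    (X := fun (i : ℕ) (w : ℕ → Instr) => (w i).drift) (P := wordMeasure ν) hY memLp_drift
    iIndepFun_drift identDistrib_drift
  rw [integral_eval_zero Instr.drift, integral_drift hp0.le hp1.le hν] at hclt
  simpa only [mul_zero, sub_zero] using hclt

/-- The central limit theorem for the sum of the first `n ^ 3 / (24 p)` drifts. -/
lemma tendstoInDistribution_sum_drift :
    TendstoInDistribution
      (fun (n : ℕ) (w : ℕ → Instr) =>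
        (∑ i ∈ Finset.range ⌊(n : ℝ) ^ 3 / (24 * p)⌋₊, (w i).drift) / (n * √n))
      atTop (id : ℝ → ℝ) (fun _ => wordMeasure ν)
      (gaussianReal 0 (Real.toNNReal ((1 - p) / 12))) := by
  have hclt := tendstoInDistribution_inv_sqrt_mul_sum_drift hp0 hp1 hν
  have ht : Tendsto (fun n : ℕ => ⌊(n : ℝ) ^ 3 / (24 * p)⌋₊) atTop atTop :=
    tendsto_nat_floor_atTop.comp (tendsto_cube_atTop.atTop_div_const (by positivity))
  have hclt' : TendstoInDistribution
      (fun (n : ℕ) (w : ℕ → Instr) => (√(⌊(n : ℝ) ^ 3 / (24 * p)⌋₊ : ℝ))⁻¹ *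
        ∑ i ∈ Finset.range ⌊(n : ℝ) ^ 3 / (24 * p)⌋₊, (w i).drift) atTop
      (fun x : ℝ => √(24 * p) * x) (fun _ => wordMeasure ν)
      (gaussianReal 0 (Real.toNNReal ((1 - p) / 12))) :=
    ⟨fun n => hclt.forall_aemeasurable _, hclt.aemeasurable_limit, hclt.tendsto.comp ht⟩
  -- Slutsky: change the normalization from √t to n√n by a deterministic factor that converges.
  have hcm : TendstoInMeasure (wordMeasure ν)
      (fun (n : ℕ) (_ : ℕ → Instr) => √(⌊(n : ℝ) ^ 3 / (24 * p)⌋₊ : ℝ) / (n * √n)) atTop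
      (fun _ => (√(24 * p))⁻¹) :=
    tendstoInMeasure_of_tendsto_ae (fun n => aestronglyMeasurable_const)
      (Eventually.of_forall fun _ => tendsto_sqrt_floor_div hp0)
  have hprod := hclt'.continuous_comp_prodMk_of_tendstoInMeasure_const
    (g := fun x : ℝ × ℝ => x.1 * x.2) (by fun_prop) hcm fun n => aemeasurable_const
  refine hprod.congr (fun n => Eventually.of_forall fun w => ?_)
    (Eventually.of_forall fun x => ?_)
  · rcases Nat.eq_zero_or_pos ⌊(n : ℝ) ^ 3 / (24 * p)⌋₊ with h0 | h0
    · simp [h0]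
    · have : √(⌊(n : ℝ) ^ 3 / (24 * p)⌋₊ : ℝ) ≠ 0 :=
        (Real.sqrt_pos.2 (by exact_mod_cast h0)).ne'
      simp only
      field_simp
  · have : √(24 * p) ≠ 0 := (Real.sqrt_pos.2 (by positivity)).ne'
    simp only [id]
    field_simp

/-- The limit theorem for functionals of the final configuration that are close to its center of
mass. -/
lemma tendstoInDistribution_finalTraj {G : ℕ → (ℤ → ℕ) → ℝ}
    (hG : ∀ n, 0 < n → ∀ η, Reachable n η → Stable η → |G n η - moment₁ n η / n| ≤ 3 / 2) :
    TendstoInDistribution (fun (n : ℕ) (w : ℕ → Instr) => G n (finalTraj n w) / √n)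
      atTop (id : ℝ → ℝ) (fun _ => wordMeasure ν)
      (gaussianReal 0 (Real.toNNReal ((1 - p) / 12))) := by
  refine tendstoInDistribution_of_tendstoInMeasure_sub _ _
    (tendstoInDistribution_sum_drift hp0 hp1 hν) ?_
    fun n => aemeasurable_finalTraj hp0 hp1 hν n fun η => G n η / √n
  rw [tendstoInMeasure_iff_measureReal_norm]
  intro ε hε
  -- 95 = 69 + 26, after bounding n² and 1 by n²√n.
  set C : ℝ := 95 / (2 * p) + 1 with hC
  have hsqrt : Tendsto (fun n : ℕ => √(n : ℝ)) atTop atTop :=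
    Real.tendsto_sqrt_atTop.comp tendsto_natCast_atTop_atTop
  have hlim : Tendsto (fun n : ℕ => 1 / (n : ℝ) + 4 * C / ε ^ 2 / √n) atTop (𝓝 0) := by
    simpa using tendsto_one_div_atTop_nhds_zero_nat.add (hsqrt.const_div_atTop (4 * C / ε ^ 2))
  refine tendsto_of_tendsto_of_tendsto_of_le_of_le' tendsto_const_nhds hlim
    (Eventually.of_forall fun n => measureReal_nonneg) ?_
  filter_upwards [eventually_gt_atTop 0, hsqrt.eventually_ge_atTop (3 / ε)] with n hn hnε
  have hn' : (0 : ℝ) < n := by exact_mod_cast hn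
  have hn1 : (1 : ℝ) ≤ n := by exact_mod_cast hn
  have hs0 : 0 < √(n : ℝ) := Real.sqrt_pos.2 hn'
  have hs1 : 1 ≤ √(n : ℝ) := Real.one_le_sqrt.2 hn1
  have hss : √(n : ℝ) * √(n : ℝ) = n := Real.mul_self_sqrt hn'.le
  set t := ⌊(n : ℝ) ^ 3 / (24 * p)⌋₊ with ht
  obtain ⟨k, htk, hk⟩ := exists_integral_unstable_le hp0 hp1 hν hn t
    (ε := 1 / n) (by positivity)
  have hmain := integral_moment₁_sub_sq_le hp0 hp1 hν hn hk htk
  rw [← ht] at hmain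
  set Dsq := fun w : ℕ → Instr =>
    (moment₁ n (traj n w k) - ∑ i ∈ Finset.range t, (w i).drift) ^ 2 with hDsq
  have hbound : ∫ w, Dsq w ∂wordMeasure ν ≤ C * (n ^ 2 * √n) := by
    refine hmain.trans ?_
    have h1 : (n : ℝ) ^ 2 ≤ n ^ 2 * √n := le_mul_of_one_le_right (by positivity) hs1
    have h2 : (1 : ℝ) ≤ n ^ 2 * √n := (one_le_pow₀ hn1).trans h1
    have h3 : C * ((n : ℝ) ^ 2 * √n) = (95 * (n ^ 2 * √n)) / (2 * p) + n ^ 2 * √n := by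
      rw [hC]; ring
    rw [h3]
    refine add_le_add (div_le_div_of_nonneg_right ?_ (by positivity)) h2
    linarith
  have dD : DependsOnFirst k Dsq := fun x y h => by
    simp only [hDsq]
    rw [traj_congr h, Finset.sum_congr rfl fun i hi =>
      congrArg Instr.drift (h i ((Finset.mem_range.1 hi).trans_le htk))]
  have hU := mul_meas_ge_le_integral_of_nonneg (μ := wordMeasure ν) (f := unstable n k)
    (Eventually.of_forall fun w => by
      rcases unstable_eq_zero_or_one n k w with h | h <;> simp [h])
    (dependsOn_unstable n k).integrable 1
  -- Chebyshev with threshold (ε/2 · n√n)² = ε²n³/4, since half of ε is spent on the rounding error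
  -- 3/2.
  have hD := mul_meas_ge_le_integral_of_nonneg (μ := wordMeasure ν) (f := Dsq)
    (Eventually.of_forall fun w => sq_nonneg _) dD.integrable (ε ^ 2 * n ^ 3 / 4)
  rw [one_mul] at hU
  have hsub : {w : ℕ → Instr | ε ≤ ‖((fun (n : ℕ) (w : ℕ → Instr) => G n (finalTraj n w) / √n) -
        fun (n : ℕ) (w : ℕ → Instr) =>
          (∑ i ∈ Finset.range ⌊(n : ℝ) ^ 3 / (24 * p)⌋₊, (w i).drift) / (n * √n)) n w
            - (0 : (ℕ → Instr) → ℝ) w‖}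
      ⊆ {w | 1 ≤ unstable n k w} ∪ {w | ε ^ 2 * n ^ 3 / 4 ≤ Dsq w} := by
    intro w hw
    simp only [Set.mem_ofPred_eq, Pi.sub_apply, Pi.zero_apply, sub_zero, Real.norm_eq_abs,
      Set.mem_union, ← ht] at hw ⊢
    by_cases hst : Stable (traj n w k)
    · right
      rw [finalTraj_eq hst] at hw
      have h1 := hG n hn _ (reachable_traj hn w k) hst
      set g := G n (traj n w k)
      set m := moment₁ n (traj n w k)
      set S := ∑ i ∈ Finset.range t, (w i).drift
      have h2 : g / √n - S / (n * √n) = (g - m / n) / √n + (m - S) / (n * √n) := by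
        field_simp; ring
      rw [h2] at hw
      have h3 := hw.trans (abs_add_le _ _)
      rw [abs_div, abs_div, abs_of_pos hs0, abs_of_pos (mul_pos hn' hs0)] at h3
      have h4 : |g - m / n| / √n ≤ ε / 2 := by
        rw [div_le_iff₀ hs0]
        rw [div_le_iff₀ hε] at hnε
        linarith
      have h5 : ε / 2 ≤ |m - S| / (n * √n) := by linarith
      rw [le_div_iff₀ (mul_pos hn' hs0)] at h5
      have h6 := pow_le_pow_left₀ (by positivity) h5 2
      rw [sq_abs] at h6
      refine le_trans (le_of_eq ?_) h6
      calc ε ^ 2 * (n : ℝ) ^ 3 / 4 = ε ^ 2 / 4 * n ^ 2 * n := by ring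
        _ = ε ^ 2 / 4 * n ^ 2 * (√n * √n) := by rw [hss]
        _ = _ := by ring
    · left
      rw [unstable_of_not_stable hst]
  refine (measureReal_mono hsub).trans ((measureReal_union_le _ _).trans
    (add_le_add (hU.trans hk) ?_))
  have h7 : (0 : ℝ) < ε ^ 2 * n ^ 3 / 4 := by positivity
  have h8 : 4 * C / ε ^ 2 / √n * (ε ^ 2 * n ^ 3 / 4) = C * (n ^ 2 * √n) := by
    have : (n : ℝ) ^ 3 = n ^ 2 * (√n * √n) := by rw [hss]; ring
    rw [this]; field_simp
  refine le_of_mul_le_mul_left ?_ h7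
  calc _ ≤ _ := hD
    _ ≤ _ := hbound
    _ = _ := by rw [← h8, mul_comm]

end Limit

/-- The limit theorem on the space of the stacks. -/
lemma IsStack.tendstoInDistribution {Ω : Type*} [MeasurableSpace Ω] {μ : Measure Ω}
    [IsProbabilityMeasure μ] {p : ℝ} (hp0 : 0 < p) (hp1 : p < 1) {ξ : ℤ → ℕ → Ω → Instr}
    (hξ : IsStack p ξ μ) {ν : Measure Instr} [IsProbabilityMeasure ν]
    (hν : ∀ a, ν {a} = ENNReal.ofReal (a.prob p)) {G : ℕ → (ℤ → ℕ) → ℝ}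
    (hG : ∀ n, 0 < n → ∀ η, Reachable n η → Stable η → |G n η - moment₁ n η / n| ≤ 3 / 2) :
    TendstoInDistribution
      (fun (n : ℕ) (ω : Ω) => G n (finalConfig (fun x i => ξ x i ω) n) / √n)
      atTop (id : ℝ → ℝ) (fun _ => μ) (gaussianReal 0 (Real.toNNReal ((1 - p) / 12))) := by
  have h := tendstoInDistribution_finalTraj hp0 hp1 hν hG
  have hmeas : ∀ n : ℕ, AEMeasurable (fun w : ℕ → Instr => G n (finalTraj n w) / √n)
      (μ.map fun ω => word (fun x j => ξ x j ω) n) := fun n => by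
    -- The words read for different `n` are different random variables but share one law, which is
    -- all that convergence in distribution sees.
    rw [hξ.map_word hν]; exact h.forall_aemeasurable n
  simp_rw [finalConfig_eq]
  refine ⟨fun n => (hmeas n).comp_measurable (hξ.measurable_word n), aemeasurable_id, ?_⟩
  refine (tendsto_congr fun n => Subtype.ext ?_).2 h.tendsto
  change μ.map ((fun w : ℕ → Instr => G n (finalTraj n w) / √n) ∘
    fun ω => word (fun x j => ξ x j ω) n) = _
  rw [← AEMeasurable.map_map_of_aemeasurable (hmeas n) (hξ.measurable_word n).aemeasurable,
    hξ.map_word hν]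

end Sandpile

theorem theorem2 {Ω : Type*} [MeasurableSpace Ω] (μ : Measure Ω) [IsProbabilityMeasure μ]
    (p : ℝ) (hp0 : 0 < p) (hp1 : p < 1) (ξ : ℤ → ℕ → Ω → Sandpile.Instr)
    (hξ : Sandpile.IsStack p ξ μ) :
    (∀ n : ℕ, ∀ᵐ ω ∂μ, ∃ k : ℕ, Sandpile.Stable (Sandpile.config (fun x i => ξ x i ω) n k)) ∧
    TendstoInDistribution
      (fun (n : ℕ) (ω : Ω) =>
        ((Sandpile.leftBdry (fun x i => ξ x i ω) n : ℝ) + (n : ℝ) / 2) / Real.sqrt (n : ℝ))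
      atTop (id : ℝ → ℝ) (fun _ => μ) (gaussianReal 0 (Real.toNNReal ((1 - p) / 12))) ∧
    TendstoInDistribution
      (fun (n : ℕ) (ω : Ω) =>
        ((Sandpile.rightBdry (fun x i => ξ x i ω) n : ℝ) - (n : ℝ) / 2) / Real.sqrt (n : ℝ))
      atTop (id : ℝ → ℝ) (fun _ => μ) (gaussianReal 0 (Real.toNNReal ((1 - p) / 12))) := by
  have := Measure.isProbabilityMeasure_map (μ := μ) (hξ.measurable 0 0).aemeasurable
  have hν : ∀ a, μ.map (ξ 0 0) {a} = ENNReal.ofReal (a.prob p) := fun a => by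
    rw [Measure.map_apply (hξ.measurable 0 0) (measurableSet_singleton a), hξ.law]
  refine ⟨fun n => ?_, ?_, ?_⟩
  · have h := Sandpile.ae_exists_stable hp0 hp1 hν n
    rw [Sandpile.wordMeasure, ← hξ.map_word hν n] at h
    filter_upwards [ae_of_ae_map (hξ.measurable_word n).aemeasurable h] with ω hω
    simpa only [Sandpile.config_eq_traj] using hω
  · exact hξ.tendstoInDistribution hp0 hp1 hν
      (G := fun n η => ((sInf {v | 0 < η v} : ℤ) : ℝ) + n / 2)
      fun n hn η hr hs => (hr.moments_of_stable hn hs).1.trans (by norm_num)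
  · exact hξ.tendstoInDistribution hp0 hp1 hν
      (G := fun n η => ((sSup {v | 0 < η v} : ℤ) : ℝ) - n / 2)
      fun n hn η hr hs => (hr.moments_of_stable hn hs).2.1
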